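/- For a Borel probability measure $\mu$ on the unit circle $\partial\mathbb{D}$ with infinite support, let $\{\Phi_n\}_{n\ge 0}$ and $\{\varphi_n\}_{n\ge 0}$ be the monic orthogonal and the orthonormal polynomials obtained by applying Gram--Schmidt to $1,z,z^2,\dots$ in $L^2(\mu)$, let $\alpha_n(\mu)=-\overline{\Phi_{n+1}(0)}$ be its Verblunsky coefficients, and put $\vec\varphi(z)=(\varphi_0(z),\varphi_1(z),\varphi_2(z),\dots)$. For $\lambda\in\partial\mathbb{D}$, let $\mu^{(\lambda)}$ be the probability measure on $\partial\mathbb{D}$ with infinite support whose Verblunsky coefficients are $\alpha_n(\mu^{(\lambda)})=\lambda\,\alpha_n(\mu)$ for all $n\geq 0$, and let $\varphi^{(\lambda)}_n$ and $\vec\varphi^{(\lambda)}(z)$ be the corresponding orthonormal polynomials and vectors. For sequences $x,y$ of complex numbers write $x\cdot y=\lim_{N\to\infty}\sum_{j=0}^{N}\overline{x_j}\,y_j$ whenever this limit exists. Let $-1/2<b<0$ and let $\mu$ be the image on $\partial\mathbb{D}$, under $\theta\mapsto e^{i\theta}$, of $\tau\,[\sin(\theta/2)]^{2b}\,d\theta$,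 $0\le\theta\le 2\pi$, where $\tau=\left(\int_0^{2\pi}[\sin(\theta/2)]^{2b}d\theta\right)^{-1}$. Let $\lambda\in\partial\mathbb{D}\setminus\{-1,1\}$. Then $\mu$ is a probability measure with infinite support, measures $\mu^{(\lambda)}$ and $\mu^{(\bar\lambda)}$ as above exist, and the following hold. 1. $\vec\varphi(1)\in\ell^\infty$ but $\vec\varphi(1)\notin\ell^1$. 2. $\{\vec\varphi^{(\lambda)}(w)\}_{w\in\partial\mathbb{D}\setminus\{1\}}$ and $\{\vec\varphi^{(\bar\lambda)}(w)\}_{w\in\partial\mathbb{D}\setminus\{1\}}$ are uncountable sets of vectors in $\ell^\infty$. 3. $\vec\varphi(1)$ is balanced with respect to these two families: for every $w\in\partial\mathbb{D}\setminus\{1\}$ the series defining $\vec\varphi(1)\cdot\vec\varphi^{(\lambda)}(w)$ and $\vec\varphi(1)\cdot\vec\varphi^{(\bar\lambda)}(w)$ converge, and $$\left\{|\vec\varphi(1)\cdot\vec\varphi^{(\lambda)}(w)| : w\in\partial\mathbb{D}\setminus\{1\}\right\}=\left\{|\vec\varphi(1)\cdot\vec\varphi^{(\bar\lambda)}(w)|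 : w\in\partial\mathbb{D}\setminus\{1\}\right\}.$$ -/

import Mathlib

open MeasureTheory Filter Topology Polynomial

noncomputable section

namespace OPUC

/-- The Borel σ-algebra of the unit circle. -/
instance instMeasurableSpaceCircle : MeasurableSpace Circle := borel Circle

instance instBorelSpaceCircle : BorelSpace Circle := ⟨rfl⟩

/-- The `L²(μ)` inner product `∫ conj(p) q dμ` of two polynomials, for a measure `μ` on the
unit circle. -/
def ip (μ : Measure Circle) (p q : ℂ[X]) : ℂ :=
  ∫ z : Circle, (starRingEnd ℂ) (p.eval (z : ℂ)) * q.eval (z : ℂ) ∂μ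

/-- The monic orthogonal polynomials `Φ_n` of `μ`: Gram-Schmidt, without normalization, applied
to `1, z, z², …` in `L²(μ)`. -/
def monicOP (μ : Measure Circle) (n : ℕ) : ℂ[X] :=
  X ^ n - ∑ k : Fin n,
    C (ip μ (monicOP μ k) (X ^ n) / ip μ (monicOP μ k) (monicOP μ k)) * monicOP μ k
termination_by n
decreasing_by all_goals exact k.isLt

/-- The orthonormal polynomials `φ_n = Φ_n / ‖Φ_n‖_{L²(μ)}`. -/
def orthonormalOP (μ : Measure Circle) (n : ℕ) : ℂ[X] :=
  C (((Real.sqrt (∫ z : Circle, ‖(monicOP μ n).eval (z : ℂ)‖ ^ 2 ∂μ))⁻¹ : ℝ) : ℂ) * monicOP μ n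

/-- The infinite vector `(φ_0(z), φ_1(z), φ_2(z), …)`. -/
def opVec (μ : Measure Circle) (z : Circle) : ℕ → ℂ :=
  fun n => (orthonormalOP μ n).eval (z : ℂ)

/-- The Verblunsky coefficients, `α_n = -conj(Φ_{n+1}(0))`. -/
def verblunsky (μ : Measure Circle) (n : ℕ) : ℂ :=
  -(starRingEnd ℂ) ((monicOP μ (n + 1)).eval 0)

/-- Borel probability measures on the unit circle with infinite support. -/
structure IsNontrivial (μ : Measure Circle) : Prop where
  isProbabilityMeasure : IsProbabilityMeasure μ
  infinite_support : μ.support.Infinite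

/-- `ν` is the Alexandrov measure `μ^(lam)`: the nontrivial probability measure on the circle
whose Verblunsky coefficients are `lam * α_n(μ)`. -/
structure IsAlexandrov (μ : Measure Circle) (lam : Circle) (ν : Measure Circle) : Prop where
  isNontrivial : IsNontrivial ν
  verblunsky_eq : ∀ n, verblunsky ν n = (lam : ℂ) * verblunsky μ n

/-- The normalization constant `τ = 1 / ∫_0^{2π} sin(θ/2)^{2b} dθ`. -/
def tau (b : ℝ) : ℝ :=
  (∫ θ in (0 : ℝ)..(2 * Real.pi), Real.sin (θ / 2) ^ (2 * b))⁻¹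

/-- The measure `τ sin(θ/2)^{2b} dθ`, `0 ≤ θ ≤ 2π`, carried to the unit circle by
`θ ↦ e^{iθ}`. -/
def sinMeasure (b : ℝ) : Measure Circle :=
  ((volume.restrict (Set.Icc (0 : ℝ) (2 * Real.pi))).withDensity
    (fun θ => ENNReal.ofReal (tau b * Real.sin (θ / 2) ^ (2 * b)))).map Circle.exp

/-- The series `∑_j conj(x_j) y_j` converges, as a limit of its partial sums (not necessarily
absolutely), to `c`. -/
def HasPairing (x y : ℕ → ℂ) (c : ℂ) : Prop :=
  Tendsto (fun N : ℕ => ∑ j ∈ Finset.range N, (starRingEnd ℂ) (x j) * y j) atTop (𝓝 c)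

/-- The set of the absolute values of the pairings of `χ` with the members of a family. -/
def pairingAbsSet {ι : Type*} (χ : ℕ → ℂ) (F : ι → ℕ → ℂ) : Set ℝ :=
  {r | ∃ i c, HasPairing χ (F i) c ∧ r = ‖c‖}

/-- `χ` is balanced with respect to two families of vectors: all the pairings converge, and
their absolute values form the same set for both families. -/
structure IsBalanced {ι κ : Type*} (χ : ℕ → ℂ) (F : ι → ℕ → ℂ) (G : κ → ℕ → ℂ) : Prop where
  converges_left : ∀ i, ∃ c, HasPairing χ (F i) c
  converges_right : ∀ k, ∃ c, HasPairing χ (G k) c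
  abs_eq : pairingAbsSet χ F = pairingAbsSet χ G

/-- The family `(φ_n(w))_n` of `μ`, indexed by the points `w ≠ 1` of the circle. -/
def opFamily (μ : Measure Circle) (w : {w : Circle // w ≠ 1}) : ℕ → ℂ :=
  opVec μ w.1

end OPUC

end

noncomputable section

namespace OPUC

-- The Verblunsky coefficients of `sinMeasure b` are a_n = -b/(n+1+b): positive, decreasing, square
-- summable, not summable. To see this, integrate the derivative of sin(θ/2)^(2b+1) e^{-i(j-1/2)θ}.
-- The boundary terms vanish, which leaves a two-term recursion for the moments
-- (`sinPairing_one_recursion`). By induction the Szegő polynomials built from a_n are then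
-- orthogonal to lower powers (`szego_pairing_eq_zero`), and this characterizes the monic orthogonal
-- polynomials. The measures with coefficients λ a_n exist by Verblunsky's theorem
-- (`exists_isNontrivial_verblunsky_eq`), obtained from Bernstein–Szegő measures and weak
-- compactness.
--
-- At z = 1 real coefficients give Φ_n(1) = ∏(1 - a_k), so φ_n(1)² = ∏(1-a_k)/(1+a_k) = ∏(1 +
-- 2b/(k+1)). This product is at most 1 and, for n ≥ 1, at least (1+2b)/n, whence boundedness and
-- failure of summability.
--
-- For the pairings, |λ a_k| = a_k makes the norms of Φ_n and Φ_n^(λ) equal, and φ_n(1) φ_n^(λ)(w) =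
-- Φ_n^(λ)(w) / ∏(1+a_k). The weights 1/∏(1+a_k) decrease to 0 because ∑ a_k diverges. For w ≠ 1 the
-- sequence w^{-n} Φ_n^(λ)(w) is bounded (`exists_bound_rotated`), and summation by parts against
-- w^n gives convergence (`exists_tendsto_sum_prod_inv_mul`).
--
-- Balancedness is a symmetry: conjugating the coefficients and the point conjugates φ_n, while
-- φ_n(1) is real. Hence w ↦ w⁻¹ matches the pairings of the two families up to conjugation.

local notation "conj" => starRingEnd ℂ

/-! ### Szegő recursion -/

/-- The pair `(Φ_n, Φ_n^*)` generated from `(1, 1)` by the Szegő recursion with coefficients `α`. -/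
def szego (α : ℕ → ℂ) : ℕ → ℂ[X] × ℂ[X]
  | 0 => (1, 1)
  | n + 1 => (X * (szego α n).1 - C (conj (α n)) * (szego α n).2,
      (szego α n).2 - C (α n) * (X * (szego α n).1))

/-- The monic polynomial `Φ_n` of the Szegő recursion. -/
def szegoPoly (α : ℕ → ℂ) (n : ℕ) : ℂ[X] := (szego α n).1

/-- The reversed polynomial `Φ_n^*` of the Szegő recursion. -/
def szegoDual (α : ℕ → ℂ) (n : ℕ) : ℂ[X] := (szego α n).2

@[simp] lemma szegoPoly_zero (α : ℕ → ℂ) : szegoPoly α 0 = 1 := rfl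

@[simp] lemma szegoDual_zero (α : ℕ → ℂ) : szegoDual α 0 = 1 := rfl

lemma szegoPoly_succ (α : ℕ → ℂ) (n : ℕ) :
    szegoPoly α (n + 1) = X * szegoPoly α n - C (conj (α n)) * szegoDual α n := rfl

lemma szegoDual_succ (α : ℕ → ℂ) (n : ℕ) :
    szegoDual α (n + 1) = szegoDual α n - C (α n) * (X * szegoPoly α n) := rfl

lemma szego_natDegree_le (α : ℕ → ℂ) (n : ℕ) :
    (szegoPoly α n).natDegree ≤ n ∧ (szegoDual α n).natDegree ≤ n := by
  induction n with
  | zero => simp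
  | succ n ih =>
    have hX : (X * szegoPoly α n).natDegree ≤ n + 1 :=
      natDegree_mul_le.trans (by have := natDegree_X_le (R := ℂ); have := ih.1; lia)
    constructor
    · rw [szegoPoly_succ]
      refine natDegree_sub_le_of_le hX ((natDegree_C_mul_le _ _).trans ?_) |>.trans (max_self _).le
      have := ih.2; lia
    · rw [szegoDual_succ]
      refine natDegree_sub_le_of_le ?_ ((natDegree_C_mul_le _ _).trans hX) |>.trans (max_self _).le
      have := ih.2; lia

lemma szegoPoly_natDegree_le (α : ℕ → ℂ) (n : ℕ) : (szegoPoly α n).natDegree ≤ n :=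
  (szego_natDegree_le α n).1

lemma szegoDual_natDegree_le (α : ℕ → ℂ) (n : ℕ) : (szegoDual α n).natDegree ≤ n :=
  (szego_natDegree_le α n).2

lemma szegoPoly_coeff_self (α : ℕ → ℂ) (n : ℕ) : (szegoPoly α n).coeff n = 1 := by
  induction n with
  | zero => simp
  | succ n ih =>
    rw [szegoPoly_succ, coeff_sub, coeff_X_mul, ih, coeff_C_mul,
      coeff_eq_zero_of_natDegree_lt (Nat.lt_succ_of_le (szegoDual_natDegree_le α n))]
    simp

lemma szegoDual_eval_zero (α : ℕ → ℂ) (n : ℕ) : (szegoDual α n).eval 0 = 1 := by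
  induction n with
  | zero => simp
  | succ n ih => simp [szegoDual_succ, ih]

lemma szegoPoly_succ_eval_zero (α : ℕ → ℂ) (n : ℕ) :
    (szegoPoly α (n + 1)).eval 0 = -conj (α n) := by
  simp [szegoPoly_succ, szegoDual_eval_zero]

lemma circle_conj_mul (z : Circle) : conj (z : ℂ) * z = 1 := by
  rw [← Complex.normSq_eq_conj_mul_self, Circle.normSq_coe]; simp

/-- Since conj z = z⁻¹ on the circle, the second component of the recursion is the reversal of the
first. Every orthogonality property of `szegoDual` comes from this identity. -/
lemma szegoDual_eval_circle (α : ℕ → ℂ) (n : ℕ) (z : Circle) :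
    (szegoDual α n).eval (z : ℂ) = (z : ℂ) ^ n * conj ((szegoPoly α n).eval (z : ℂ)) := by
  induction n with
  | zero => simp
  | succ n ih =>
    have h := circle_conj_mul z
    simp only [szegoDual_succ, szegoPoly_succ, eval_sub, eval_mul, eval_C, eval_X, map_sub, map_mul,
      ih, map_pow, Complex.conj_conj, pow_succ]
    have hn : conj (z : ℂ) ^ n * (z : ℂ) ^ n = 1 := by rw [← mul_pow, h, one_pow]
    linear_combination (-((z : ℂ) ^ n * conj (eval (z : ℂ) (szegoPoly α n)))) * h
      + (α n * z * eval (z : ℂ) (szegoPoly α n)) * hn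

/-! ### The inner product on polynomials -/

lemma continuous_eval_circle (p : ℂ[X]) : Continuous fun z : Circle => p.eval (z : ℂ) :=
  p.continuous.comp (by fun_prop)

lemma integrable_of_continuous (μ : Measure Circle) [IsFiniteMeasure μ] {f : Circle → ℂ}
    (hf : Continuous f) : Integrable f μ :=
  hf.integrable_of_hasCompactSupport (HasCompactSupport.of_compactSpace f)

lemma continuous_ip_integrand (p q : ℂ[X]) :
    Continuous fun z : Circle => conj (p.eval (z : ℂ)) * q.eval (z : ℂ) :=
  (Complex.continuous_conj.comp (continuous_eval_circle p)).mul (continuous_eval_circle q)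

lemma integrable_ip (μ : Measure Circle) [IsFiniteMeasure μ] (p q : ℂ[X]) :
    Integrable (fun z : Circle => conj (p.eval (z : ℂ)) * q.eval (z : ℂ)) μ :=
  integrable_of_continuous μ (continuous_ip_integrand p q)

lemma ip_conj_symm (μ : Measure Circle) (p q : ℂ[X]) : conj (ip μ p q) = ip μ q p := by
  unfold ip
  rw [← integral_conj]
  simp [mul_comm]

lemma ip_C_mul_right (μ : Measure Circle) (p q : ℂ[X]) (c : ℂ) :
    ip μ p (C c * q) = c * ip μ p q := by
  unfold ip
  rw [← integral_const_mul]
  simp [mul_left_comm]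

lemma ip_C_mul_left (μ : Measure Circle) (p q : ℂ[X]) (c : ℂ) :
    ip μ (C c * p) q = conj c * ip μ p q := by
  rw [← ip_conj_symm, ip_C_mul_right, map_mul, ip_conj_symm]

lemma ip_X_mul_X_mul (μ : Measure Circle) (p q : ℂ[X]) : ip μ (X * p) (X * q) = ip μ p q := by
  unfold ip
  congr 1
  ext z
  have h := circle_conj_mul z
  simp only [eval_mul, eval_X, map_mul]
  linear_combination (conj (p.eval (z : ℂ)) * q.eval (z : ℂ)) * h

section FiniteMeasure

variable (μ : Measure Circle) [IsFiniteMeasure μ]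

lemma ip_add_right (p q r : ℂ[X]) : ip μ p (q + r) = ip μ p q + ip μ p r := by
  unfold ip
  rw [← integral_add (integrable_ip μ p q) (integrable_ip μ p r)]
  simp [mul_add]

lemma ip_sub_right (p q r : ℂ[X]) : ip μ p (q - r) = ip μ p q - ip μ p r := by
  have : q - r = q + C (-1) * r := by simp [sub_eq_add_neg]
  rw [this, ip_add_right, ip_C_mul_right]; ring

lemma ip_sum_right {ι : Type*} (s : Finset ι) (p : ℂ[X]) (f : ι → ℂ[X]) :
    ip μ p (∑ i ∈ s, f i) = ∑ i ∈ s, ip μ p (f i) := by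
  classical
  induction s using Finset.induction_on with
  | empty => simp [ip]
  | insert i s hi ih => rw [Finset.sum_insert hi, Finset.sum_insert hi, ip_add_right, ih]

lemma ip_add_left (p q r : ℂ[X]) : ip μ (p + q) r = ip μ p r + ip μ q r := by
  rw [← ip_conj_symm, ip_add_right, map_add, ip_conj_symm, ip_conj_symm]

lemma ip_sum_left {ι : Type*} (s : Finset ι) (p : ℂ[X]) (f : ι → ℂ[X]) :
    ip μ (∑ i ∈ s, f i) p = ∑ i ∈ s, ip μ (f i) p := by
  rw [← ip_conj_symm, ip_sum_right, map_sum]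
  simp [ip_conj_symm]

variable {μ}

/-- Only powers that actually occur in q are tested, so a difference whose top or constant
coefficient cancels can be handled without lowering its degree bound. -/
lemma ip_eq_zero_of_natDegree_le {p q : ℂ[X]} {n : ℕ} (hq : q.natDegree ≤ n)
    (h : ∀ j ≤ n, q.coeff j ≠ 0 → ip μ (X ^ j) p = 0) : ip μ q p = 0 := by
  rw [q.as_sum_range' (n + 1) (Nat.lt_succ_of_le hq), ip_sum_left]
  refine Finset.sum_eq_zero fun j hj => ?_
  rw [← C_mul_X_pow_eq_monomial, ip_C_mul_left]
  by_cases hc : q.coeff j = 0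
  · simp [hc]
  · rw [h j (Nat.lt_succ_iff.mp (Finset.mem_range.mp hj)) hc, mul_zero]

/-- If `p` is orthogonal to all lower powers, its pairing with `q` sees the top coefficient only. -/
lemma ip_eq_coeff_mul_of_orth {p q : ℂ[X]} {n : ℕ} (hp : p.natDegree ≤ n) (hp1 : p.coeff n = 1)
    (h : ∀ j < n, ip μ (X ^ j) p = 0) (hq : q.natDegree ≤ n) :
    ip μ p q = q.coeff n * ip μ p p := by
  have : ip μ (q - C (q.coeff n) * p) p = 0 := by
    refine ip_eq_zero_of_natDegree_le (n := n)
      ((natDegree_sub_le_of_le hq ((natDegree_C_mul_le _ _).trans hp)).trans (max_self _).le)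
      fun j hj hc => ?_
    rcases hj.lt_or_eq with hj | rfl
    · exact h j hj
    · simp [hp1] at hc
  rw [← ip_conj_symm, map_eq_zero, ip_sub_right, ip_C_mul_right] at this
  exact sub_eq_zero.mp this

/-! ### Orthogonality of the Szegő polynomials -/

/-- `Φ_n` is orthogonal to all lower powers. -/
def IsOrth (μ : Measure Circle) (α : ℕ → ℂ) (n : ℕ) : Prop :=
  ∀ j < n, ip μ (X ^ j) (szegoPoly α n) = 0

variable {α : ℕ → ℂ} {n : ℕ}

lemma ip_eq_zero_of_lt {p q : ℂ[X]} (h : ∀ j < n, ip μ (X ^ j) p = 0)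
    (hq : q.natDegree < n) : ip μ q p = 0 :=
  ip_eq_zero_of_natDegree_le le_rfl fun j hj _ => h j (hj.trans_lt hq)

/-- Reversal turns the pairing of z^j with Φ_n^* into that of Φ_n with z^(n-j), and 0 ≤ n-j < n. -/
lemma IsOrth.ip_X_pow_dual {μ : Measure Circle} (h : IsOrth μ α n) {j : ℕ} (hj : 1 ≤ j)
    (hjn : j ≤ n) : ip μ (X ^ j) (szegoDual α n) = 0 := by
  have key : ip μ (X ^ j) (szegoDual α n) = ip μ (szegoPoly α n) (X ^ (n - j)) := by
    unfold ip
    congr 1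
    ext z
    have h1 : conj (z : ℂ) ^ j * (z : ℂ) ^ j = 1 := by rw [← mul_pow, circle_conj_mul, one_pow]
    have h2 : (z : ℂ) ^ n = (z : ℂ) ^ j * (z : ℂ) ^ (n - j) := by rw [← pow_add]; congr 1; lia
    simp only [eval_pow, eval_X, map_pow, szegoDual_eval_circle, h2]
    linear_combination ((z : ℂ) ^ (n - j) * conj ((szegoPoly α n).eval (z : ℂ))) * h1
  rw [key, ← ip_conj_symm, h _ (by lia), map_zero]

lemma ip_dual_dual (μ : Measure Circle) (α : ℕ → ℂ) (n : ℕ) :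
    ip μ (szegoDual α n) (szegoDual α n) = ip μ (szegoPoly α n) (szegoPoly α n) := by
  unfold ip
  congr 1
  ext z
  have h1 : conj (z : ℂ) ^ n * (z : ℂ) ^ n = 1 := by rw [← mul_pow, circle_conj_mul, one_pow]
  simp only [szegoDual_eval_circle, map_mul, map_pow, Complex.conj_conj]
  linear_combination ((szegoPoly α n).eval (z : ℂ) * conj ((szegoPoly α n).eval (z : ℂ))) * h1

/-- Pythagoras for z Φ_n = Φ_{n+1} + conj(α_n) Φ_n^*: the summands are orthogonal, multiplication by
z is isometric, and Φ_n^* has the norm of Φ_n. -/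
lemma IsOrth.ip_succ (h : IsOrth μ α (n + 1)) :
    ip μ (szegoPoly α (n + 1)) (szegoPoly α (n + 1)) =
      (1 - (‖α n‖ : ℂ) ^ 2) * ip μ (szegoPoly α n) (szegoPoly α n) := by
  have e : X * szegoPoly α n = szegoPoly α (n + 1) + C (conj (α n)) * szegoDual α n := by
    rw [szegoPoly_succ]; ring
  have h0 : ip μ (szegoDual α n) (szegoPoly α (n + 1)) = 0 :=
    ip_eq_zero_of_lt h (Nat.lt_succ_of_le (szegoDual_natDegree_le α n))
  have h0' : ip μ (szegoPoly α (n + 1)) (szegoDual α n) = 0 := by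
    rw [← ip_conj_symm, h0, map_zero]
  have := ip_X_mul_X_mul μ (szegoPoly α n) (szegoPoly α n)
  rw [e, ip_add_left, ip_add_right, ip_add_right, ip_C_mul_left, ip_C_mul_left, ip_C_mul_right,
    ip_C_mul_right, h0, h0', ip_dual_dual, Complex.conj_conj] at this
  have hn : α n * conj (α n) = (‖α n‖ : ℂ) ^ 2 := Complex.mul_conj' (α n)
  linear_combination this - hn * ip μ (szegoPoly α n) (szegoPoly α n)

lemma ip_one_one (μ : Measure Circle) [IsProbabilityMeasure μ] : ip μ 1 1 = 1 := by
  simp [ip]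

lemma ip_szegoPoly_self {μ : Measure Circle} [IsProbabilityMeasure μ] (h : ∀ n, IsOrth μ α n)
    (n : ℕ) : ip μ (szegoPoly α n) (szegoPoly α n) =
      ((∏ k ∈ Finset.range n, (1 - ‖α k‖ ^ 2) : ℝ) : ℂ) := by
  induction n with
  | zero => simp [ip_one_one]
  | succ n ih => rw [(h (n + 1)).ip_succ, ih, Finset.prod_range_succ]; push_cast; ring

lemma ip_self (μ : Measure Circle) (p : ℂ[X]) :
    ip μ p p = ((∫ z : Circle, ‖p.eval (z : ℂ)‖ ^ 2 ∂μ : ℝ) : ℂ) := by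
  unfold ip
  rw [← integral_complex_ofReal]
  congr 1
  ext z
  rw [Complex.conj_mul']
  push_cast; rfl

/-- The inner product is definite when the support is infinite. -/
lemma eq_zero_of_ip_self_eq_zero (hμ : μ.support.Infinite) {p : ℂ[X]} (hp : ip μ p p = 0) :
    p = 0 := by
  by_contra hne
  apply hμ
  have hc : Continuous fun z : Circle => ‖p.eval (z : ℂ)‖ ^ 2 :=
    (continuous_eval_circle p).norm.pow 2
  rw [ip_self, Complex.ofReal_eq_zero, integral_eq_zero_iff_of_nonneg (fun z => by positivity)
    (hc.integrable_of_hasCompactSupport (HasCompactSupport.of_compactSpace _))] at hp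
  have hopen : IsOpen {z : Circle | p.eval (z : ℂ) ≠ 0} :=
    isOpen_ne.preimage (continuous_eval_circle p)
  have hnull : μ {z : Circle | p.eval (z : ℂ) ≠ 0} = 0 := by
    rw [← compl_compl {z : Circle | p.eval (z : ℂ) ≠ 0}]
    refine mem_ae_iff.mp ?_
    filter_upwards [hp] with z hz
    simpa using hz
  have hsub := Measure.subset_compl_support_of_isOpen hopen hnull
  refine Set.Finite.subset (Set.Finite.preimage (f := fun z : Circle => (z : ℂ))
    (Circle.coe_injective.injOn) (p.roots.toFinset.finite_toSet)) fun z hz => ?_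
  by_contra hz'
  refine hsub ?_ hz
  intro h0
  exact hz' (by simpa [hne] using h0)

/-- A measure for which monic polynomials of every degree exist that are orthogonal to the lower
powers and have nonzero norm has infinite support. -/
lemma infinite_support_of_isOrth (h : ∀ n, IsOrth μ α n)
    (hne : ∀ n, ip μ (szegoPoly α n) (szegoPoly α n) ≠ 0) : μ.support.Infinite := by
  intro hfin
  -- A monic polynomial vanishing on a finite support pairs to 0 with Φ_N, N its degree; by
  -- orthogonality the same pairing is ‖Φ_N‖².
  set p : ℂ[X] := ∏ s ∈ hfin.toFinset, (X - C (s : ℂ)) with hp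
  have hmon : p.Monic := monic_prod_of_monic _ _ fun s _ => monic_X_sub_C _
  have key := ip_eq_coeff_mul_of_orth (szegoPoly_natDegree_le α p.natDegree)
    (szegoPoly_coeff_self α _) (h p.natDegree) (le_refl p.natDegree)
  rw [coeff_natDegree, hmon.leadingCoeff, one_mul] at key
  refine hne _ (key.symm.trans ?_)
  refine integral_eq_zero_of_ae ?_
  filter_upwards [μ.support_mem_ae] with z hz
  have : p.eval (z : ℂ) = 0 := by
    rw [hp, eval_prod]
    exact Finset.prod_eq_zero (hfin.mem_toFinset.mpr hz) (by simp)
  simp [this]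

/-! ### The monic orthogonal polynomials -/

lemma monicOP_eq (μ : Measure Circle) (n : ℕ) : monicOP μ n = X ^ n - ∑ k ∈ Finset.range n,
    C (ip μ (monicOP μ k) (X ^ n) / ip μ (monicOP μ k) (monicOP μ k)) * monicOP μ k := by
  rw [monicOP, Finset.sum_range]

lemma monicOP_natDegree_le (μ : Measure Circle) (n : ℕ) : (monicOP μ n).natDegree ≤ n := by
  induction n using Nat.strong_induction_on with
  | _ n ih =>
    rw [monicOP_eq]
    refine (natDegree_sub_le_of_le (natDegree_X_pow_le n)
      (natDegree_sum_le_of_forall_le _ _ fun k hk => ?_)).trans (max_self n).le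
    have hk := Finset.mem_range.mp hk
    exact (natDegree_C_mul_le _ _).trans ((ih k hk).trans hk.le)

lemma monicOP_coeff_self (μ : Measure Circle) (n : ℕ) : (monicOP μ n).coeff n = 1 := by
  rw [monicOP_eq, coeff_sub, coeff_X_pow_self, finsetSum_coeff, Finset.sum_eq_zero, sub_zero]
  intro k hk
  rw [coeff_C_mul, coeff_eq_zero_of_natDegree_lt
    ((monicOP_natDegree_le μ k).trans_lt (Finset.mem_range.mp hk)), mul_zero]

lemma monicOP_ne_zero (μ : Measure Circle) (n : ℕ) : monicOP μ n ≠ 0 := fun h => by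
  simpa [h] using monicOP_coeff_self μ n

lemma ip_monicOP_monicOP (hμ : μ.support.Infinite) {k n : ℕ} (hk : k < n) :
    ip μ (monicOP μ k) (monicOP μ n) = 0 := by
  induction n using Nat.strong_induction_on generalizing k with
  | _ n ih =>
    rw [monicOP_eq μ n, ip_sub_right, ip_sum_right, Finset.sum_eq_single k]
    · rw [ip_C_mul_right, div_mul_cancel₀, sub_self]
      exact fun h => monicOP_ne_zero μ k (eq_zero_of_ip_self_eq_zero hμ h)
    · intro l hl hlk
      rw [ip_C_mul_right]
      rcases hlk.lt_or_gt with h | h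
      · rw [← ip_conj_symm μ (monicOP μ l) (monicOP μ k), ih k hk h, map_zero, mul_zero]
      · rw [ih l (Finset.mem_range.mp hl) h, mul_zero]
    · exact fun h => absurd (Finset.mem_range.mpr hk) h

lemma ip_X_pow_monicOP (hμ : μ.support.Infinite) {j n : ℕ} (hj : j < n) :
    ip μ (X ^ j) (monicOP μ n) = 0 := by
  have e : (X : ℂ[X]) ^ j = monicOP μ j + ∑ k ∈ Finset.range j,
      C (ip μ (monicOP μ k) (X ^ j) / ip μ (monicOP μ k) (monicOP μ k)) * monicOP μ k := by
    rw [monicOP_eq μ j]; ring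
  rw [e, ip_add_left, ip_monicOP_monicOP hμ hj, ip_sum_left, zero_add]
  refine Finset.sum_eq_zero fun k hk => ?_
  rw [ip_C_mul_left, ip_monicOP_monicOP hμ ((Finset.mem_range.mp hk).trans hj), mul_zero]

/-- The monic orthogonal polynomial is characterized by its orthogonality to lower powers. -/
lemma eq_monicOP_of_orth (hμ : μ.support.Infinite) {p : ℂ[X]} (hp : p.natDegree ≤ n)
    (hp1 : p.coeff n = 1) (h : ∀ j < n, ip μ (X ^ j) p = 0) : monicOP μ n = p := by
  rw [← sub_eq_zero]
  refine eq_zero_of_ip_self_eq_zero hμ (ip_eq_zero_of_natDegree_le (n := n)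
    ((natDegree_sub_le_of_le (monicOP_natDegree_le μ n) hp).trans (max_self n).le) fun j hj hc => ?_)
  rcases hj.lt_or_eq with hj | rfl
  · rw [ip_sub_right, ip_X_pow_monicOP hμ hj, h j hj, sub_zero]
  · simp [hp1, monicOP_coeff_self] at hc

/-- **Szegő recursion**: the monic orthogonal polynomials are generated by the Verblunsky
coefficients. -/
lemma monicOP_eq_szegoPoly (hμ : μ.support.Infinite) (n : ℕ) :
    monicOP μ n = szegoPoly (verblunsky μ) n := by
  induction n with
  | zero => rw [monicOP_eq]; simp
  | succ n ih =>
    have ho : IsOrth μ (verblunsky μ) n := fun j hj => by rw [← ih]; exact ip_X_pow_monicOP hμ hj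
    -- The difference has no top coefficient (both are monic) and no constant term (definition of
    -- `verblunsky`), and it is orthogonal to the powers in between; so it is orthogonal to itself.
    rw [← sub_eq_zero]
    refine eq_zero_of_ip_self_eq_zero hμ (ip_eq_zero_of_natDegree_le (n := n + 1)
      ((natDegree_sub_le_of_le (monicOP_natDegree_le μ _) (szegoPoly_natDegree_le _ _)).trans
        (max_self _).le) fun j hj hc => ?_)
    rcases hj.lt_or_eq with hj | rfl
    · rcases j with _ | j
      · rw [coeff_zero_eq_eval_zero, eval_sub, szegoPoly_succ_eval_zero] at hc
        simp [verblunsky] at hc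
      · rw [ip_sub_right, ip_X_pow_monicOP hμ hj, szegoPoly_succ, ip_sub_right, ip_C_mul_right,
          ho.ip_X_pow_dual (by lia) (by lia), pow_succ', ip_X_mul_X_mul, ho j (by lia)]
        simp
    · simp [szegoPoly_coeff_self, monicOP_coeff_self] at hc

lemma isOrth_verblunsky (hμ : μ.support.Infinite) (n : ℕ) : IsOrth μ (verblunsky μ) n := by
  intro j hj
  rw [← monicOP_eq_szegoPoly hμ]
  exact ip_X_pow_monicOP hμ hj

end FiniteMeasure

/-- The squared norm of the monic orthogonal polynomial as a function of the Verblunsky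
coefficients. -/
def normProd (α : ℕ → ℂ) (n : ℕ) : ℝ := ∏ k ∈ Finset.range n, (1 - ‖α k‖ ^ 2)

lemma normProd_pos {α : ℕ → ℂ} (hα : ∀ n, ‖α n‖ < 1) (n : ℕ) : 0 < normProd α n :=
  Finset.prod_pos fun k _ => by have := hα k; have := norm_nonneg (α k); nlinarith

/-- A probability measure for which all Szegő polynomials of `α` are orthogonal is nontrivial and
has Verblunsky coefficients `α`. -/
lemma isNontrivial_of_isOrth {μ : Measure Circle} [IsProbabilityMeasure μ] {α : ℕ → ℂ}
    (hα : ∀ n, ‖α n‖ < 1) (h : ∀ n, IsOrth μ α n) :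
    IsNontrivial μ ∧ ∀ n, verblunsky μ n = α n := by
  have hinf : μ.support.Infinite := by
    refine infinite_support_of_isOrth h fun n => ?_
    rw [ip_szegoPoly_self h, Complex.ofReal_ne_zero]
    exact (normProd_pos hα n).ne'
  refine ⟨⟨inferInstance, hinf⟩, fun n => ?_⟩
  rw [verblunsky, eq_monicOP_of_orth hinf (szegoPoly_natDegree_le α _) (szegoPoly_coeff_self α _)
    (h (n + 1)), szegoPoly_succ_eval_zero]
  simp

/-- The orthonormal polynomials in terms of the Verblunsky coefficients. -/
lemma opVec_eq {μ : Measure Circle} (hμ : IsNontrivial μ) {α : ℕ → ℂ}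
    (hα : ∀ n, verblunsky μ n = α n) (z : Circle) (n : ℕ) :
    opVec μ z n = (((Real.sqrt (normProd α n))⁻¹ : ℝ) : ℂ) * (szegoPoly α n).eval (z : ℂ) := by
  obtain rfl : verblunsky μ = α := funext hα
  have := hμ.isProbabilityMeasure
  have h := ip_szegoPoly_self (isOrth_verblunsky hμ.infinite_support) n
  rw [ip_self, Complex.ofReal_inj] at h
  rw [opVec, orthonormalOP, eval_mul, eval_C, monicOP_eq_szegoPoly hμ.infinite_support, h, normProd]

/-! ### Absolutely continuous measures on the circle -/

/-- The measure `f(θ) dθ`, `0 ≤ θ ≤ 2π`, carried to the circle. -/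
def densityMeasure (f : ℝ → ℝ) : Measure Circle :=
  ((volume.restrict (Set.Icc (0 : ℝ) (2 * Real.pi))).withDensity
    (fun θ => ENNReal.ofReal (f θ))).map Circle.exp

lemma measurable_circleExp : Measurable (fun θ : ℝ => Circle.exp θ) :=
  Circle.exp.continuous.measurable

lemma integral_densityMeasure {f : ℝ → ℝ} (hf : IntervalIntegrable f volume 0 (2 * Real.pi))
    (h0 : ∀ θ ∈ Set.Icc 0 (2 * Real.pi), 0 ≤ f θ) {g : Circle → ℂ} (hg : Continuous g) :
    ∫ z, g z ∂densityMeasure f = ∫ θ in 0..2 * Real.pi, (f θ : ℂ) * g (Circle.exp θ) := by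
  have hpi : (0 : ℝ) ≤ 2 * Real.pi := Real.two_pi_pos.le
  have hf' : IntegrableOn f (Set.Icc 0 (2 * Real.pi)) :=
    (intervalIntegrable_iff_integrableOn_Icc_of_le hpi).mp hf
  rw [densityMeasure, integral_map measurable_circleExp.aemeasurable
    hg.aestronglyMeasurable, integral_withDensity_eq_integral_toReal_smul₀
    hf'.1.aemeasurable.ennreal_ofReal (by simp), intervalIntegral.integral_of_le hpi,
    ← integral_Icc_eq_integral_Ioc]
  refine setIntegral_congr_fun measurableSet_Icc fun θ hθ => ?_
  simp [ENNReal.toReal_ofReal (h0 θ hθ)]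

lemma isProbabilityMeasure_densityMeasure {f : ℝ → ℝ}
    (hf : IntervalIntegrable f volume 0 (2 * Real.pi))
    (h0 : ∀ θ ∈ Set.Icc 0 (2 * Real.pi), 0 ≤ f θ) (h1 : ∫ θ in 0..2 * Real.pi, f θ = 1) :
    IsProbabilityMeasure (densityMeasure f) := by
  have hpi : (0 : ℝ) ≤ 2 * Real.pi := Real.two_pi_pos.le
  have hf' : IntegrableOn f (Set.Icc 0 (2 * Real.pi)) :=
    (intervalIntegrable_iff_integrableOn_Icc_of_le hpi).mp hf
  constructor
  rw [densityMeasure, Measure.map_apply measurable_circleExp MeasurableSet.univ, Set.preimage_univ,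
    withDensity_apply _ MeasurableSet.univ, Measure.restrict_univ,
    ← ofReal_integral_eq_lintegral_ofReal hf', integral_Icc_eq_integral_Ioc,
    ← intervalIntegral.integral_of_le hpi, h1, ENNReal.ofReal_one]
  exact (ae_restrict_iff' measurableSet_Icc).mpr (Eventually.of_forall h0)

/-! ### Bernstein–Szegő measures -/

/-- With p = zΦ_n and q = Φ_n^*, the bound follows from |q - αp|² - |p - conj(α)q|² =
(1-|α|²)(|q|²-|p|²). A zero q = αp is excluded by |p| ≤ |q|, q ≠ 0 and |α| < 1. -/
lemma szego_closedDisc {α : ℕ → ℂ} (hα : ∀ n, ‖α n‖ < 1) (n : ℕ) {z : ℂ} (hz : ‖z‖ ≤ 1) :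
    (szegoDual α n).eval z ≠ 0 ∧
      ‖(szegoPoly α n).eval z‖ ≤ ‖(szegoDual α n).eval z‖ := by
  induction n with
  | zero => simp
  | succ n ih =>
    obtain ⟨h0, hle⟩ := ih
    set p := z * (szegoPoly α n).eval z with hp
    set q := (szegoDual α n).eval z with hq
    have hpq : ‖p‖ ≤ ‖q‖ := by
      rw [hp, norm_mul]
      exact (mul_le_of_le_one_left (norm_nonneg _) hz).trans hle
    have hq0 : 0 < ‖q‖ := norm_pos_iff.mpr h0
    have e1 : (szegoPoly α (n + 1)).eval z = p - conj (α n) * q := by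
      simp [szegoPoly_succ, hp, hq]
    have e2 : (szegoDual α (n + 1)).eval z = q - α n * p := by
      simp [szegoDual_succ, hp, hq]
    rw [e1, e2]
    have ha := hα n
    constructor
    · intro h
      have : ‖q‖ = ‖α n‖ * ‖p‖ := by rw [← norm_mul, sub_eq_zero.mp h]
      nlinarith [norm_nonneg p, norm_nonneg (α n)]
    · rw [← sq_le_sq₀ (norm_nonneg _) (norm_nonneg _)]
      have key : ‖q - α n * p‖ ^ 2 - ‖p - conj (α n) * q‖ ^ 2 =
          (1 - ‖α n‖ ^ 2) * (‖q‖ ^ 2 - ‖p‖ ^ 2) := by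
        simp only [Complex.sq_norm, Complex.normSq_apply, Complex.sub_re, Complex.sub_im,
          Complex.mul_re, Complex.mul_im, Complex.conj_re, Complex.conj_im]
        ring
      have h1 : 0 ≤ 1 - ‖α n‖ ^ 2 := by nlinarith [norm_nonneg (α n)]
      have h2 : 0 ≤ ‖q‖ ^ 2 - ‖p‖ ^ 2 := by nlinarith [norm_nonneg p]
      nlinarith [mul_nonneg h1 h2]

lemma szegoPoly_eval_circle_ne_zero {α : ℕ → ℂ} (hα : ∀ n, ‖α n‖ < 1) (n : ℕ) (z : Circle) :
    (szegoPoly α n).eval (z : ℂ) ≠ 0 := by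
  intro h
  apply (szego_closedDisc hα n z.norm_coe.le).1
  rw [szegoDual_eval_circle, h]; simp

/-- Orthogonality passes from `Φ_{n+1}` down to `Φ_n`. -/
lemma IsOrth.of_succ {μ : Measure Circle} [IsFiniteMeasure μ] {α : ℕ → ℂ} {n : ℕ}
    (hα : ‖α n‖ < 1) (h : IsOrth μ α (n + 1)) : IsOrth μ α n := by
  intro j hj
  -- This inverts the Szegő step, expressing zΦ_n through Φ_{n+1} and Φ_{n+1}^*, both orthogonal to
  -- z^(j+1).
  have e : szegoPoly α (n + 1) + C (conj (α n)) * szegoDual α (n + 1) =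
      C (1 - (‖α n‖ : ℂ) ^ 2) * (X * szegoPoly α n) := by
    rw [← Complex.mul_conj', szegoPoly_succ, szegoDual_succ]
    simp only [C_sub, C_mul, C_1]
    ring
  have := congrArg (ip μ (X ^ (j + 1))) e
  rw [ip_add_right, ip_C_mul_right, ip_C_mul_right, h _ (by lia),
    h.ip_X_pow_dual (by lia) (by lia), pow_succ' X, ip_X_mul_X_mul] at this
  have hne : (1 - (‖α n‖ : ℂ) ^ 2) ≠ 0 := by
    have : (1 - ‖α n‖ ^ 2 : ℝ) ≠ 0 := by nlinarith [norm_nonneg (α n)]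
    exact_mod_cast this
  simpa [hne] using this.symm

/-- The Bernstein–Szegő measure, proportional to `dθ / |Φ_N|²`, makes `Φ_N` orthogonal to the lower
powers. -/
lemma exists_isProbabilityMeasure_isOrth {α : ℕ → ℂ} (hα : ∀ n, ‖α n‖ < 1) (N : ℕ) :
    ∃ μ : Measure Circle, IsProbabilityMeasure μ ∧ IsOrth μ α N := by
  set r : ℝ → ℝ := fun θ => (‖(szegoPoly α N).eval (Circle.exp θ : ℂ)‖ ^ 2)⁻¹ with hr
  have hpos : ∀ θ, 0 < r θ := fun θ =>
    inv_pos.mpr (pow_pos (norm_pos_iff.mpr (szegoPoly_eval_circle_ne_zero hα N _)) 2)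
  have hrc : Continuous r := by
    refine Continuous.inv₀ ((((continuous_eval_circle _).comp Circle.exp.continuous).norm).pow 2)
      fun θ => (pow_pos (norm_pos_iff.mpr (szegoPoly_eval_circle_ne_zero hα N _)) 2).ne'
  set c := ∫ θ in 0..2 * Real.pi, r θ with hc
  have hcpos : 0 < c := intervalIntegral.intervalIntegral_pos_of_pos
    (hrc.intervalIntegrable _ _) hpos Real.two_pi_pos
  have hint : IntervalIntegrable (fun θ => c⁻¹ * r θ) volume 0 (2 * Real.pi) :=
    (hrc.const_mul _ |>.intervalIntegrable _ _)
  have hnn : ∀ θ ∈ Set.Icc 0 (2 * Real.pi), 0 ≤ c⁻¹ * r θ := fun θ _ => by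
    have := hpos θ; positivity
  refine ⟨densityMeasure fun θ => c⁻¹ * r θ, isProbabilityMeasure_densityMeasure hint hnn ?_, ?_⟩
  · rw [intervalIntegral.integral_const_mul, ← hc, inv_mul_cancel₀ hcpos.ne']
  intro j hj
  rw [ip, integral_densityMeasure hint hnn (continuous_ip_integrand _ _)]
  -- On the circle conj(z^j) Φ_N / |Φ_N|² = z^(N-j) / Φ_N^*. This is analytic on the closed disc and
  -- vanishes at 0 because j < N, so its circle average is 0.
  set h : ℂ → ℂ := fun z => z ^ (N - j) / (szegoDual α N).eval z with hh
  have hd : DifferentiableOn ℂ h (Metric.closedBall 0 1) := by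
    refine DifferentiableOn.div (differentiable_id.pow _).differentiableOn
      (szegoDual α N).differentiable.differentiableOn fun z hz => ?_
    exact (szego_closedDisc hα N (by simpa using hz)).1
  have hmean : Real.circleAverage h 0 1 = 0 := by
    rw [DiffContOnCl.circleAverage]
    · simp [hh, Nat.sub_ne_zero_of_lt hj]
    · refine DifferentiableOn.diffContOnCl ?_
      rw [abs_one, closure_ball _ one_ne_zero]
      exact hd
  rw [Real.circleAverage, smul_eq_zero] at hmean
  replace hmean := hmean.resolve_left (by positivity)
  calc _ = ∫ θ in 0..2 * Real.pi, (c⁻¹ : ℂ) * h (circleMap 0 1 θ) := by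
        congr 1
        ext θ
        have hz : circleMap 0 1 θ = (Circle.exp θ : ℂ) := by simp [circleMap, Circle.coe_exp]
        set z := Circle.exp θ
        have hne := szegoPoly_eval_circle_ne_zero hα N z
        have hne' : conj ((szegoPoly α N).eval (z : ℂ)) ≠ 0 := by simpa using hne
        have hz0 : (z : ℂ) ≠ 0 := z.coe_ne_zero
        have hcz : conj (z : ℂ) = (z : ℂ)⁻¹ := eq_inv_of_mul_eq_one_left (circle_conj_mul z)
        have hpw : (z : ℂ) ^ N = (z : ℂ) ^ (N - j) * (z : ℂ) ^ j := by rw [← pow_add]; congr 1; lia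
        have hrz : (r θ : ℂ) =
            (conj ((szegoPoly α N).eval (z : ℂ)) * (szegoPoly α N).eval (z : ℂ))⁻¹ := by
          rw [Complex.conj_mul', ← Complex.ofReal_pow, ← Complex.ofReal_inv]
        rw [hz, Complex.ofReal_mul, hrz, Complex.ofReal_inv, eval_pow, eval_X, map_pow, hcz, inv_pow]
        simp only [hh, szegoDual_eval_circle, hpw]
        field_simp
    _ = 0 := by rw [intervalIntegral.integral_const_mul, hmean, mul_zero]

/-! ### Weak compactness and Verblunsky's theorem -/

lemma continuous_integral_probabilityMeasure {f : Circle → ℂ} (hf : Continuous f) :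
    Continuous fun μ : ProbabilityMeasure Circle => ∫ z, f z ∂(μ : Measure Circle) := by
  have hreal : ∀ g : Circle → ℝ, Continuous g →
      Continuous fun μ : ProbabilityMeasure Circle => ∫ z, g z ∂(μ : Measure Circle) := by
    intro g hg
    rw [continuous_iff_continuousAt]
    intro μ
    exact (ProbabilityMeasure.tendsto_iff_forall_integral_tendsto.mp tendsto_id)
      (BoundedContinuousFunction.mkOfCompact ⟨g, hg⟩)
  have e : (fun μ : ProbabilityMeasure Circle => ∫ z, f z ∂(μ : Measure Circle)) =
      fun μ : ProbabilityMeasure Circle =>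
      ((∫ z, (f z).re ∂(μ : Measure Circle) : ℝ) : ℂ) +
        ((∫ z, (f z).im ∂(μ : Measure Circle) : ℝ) : ℂ) * Complex.I := by
    ext μ
    exact (integral_re_add_im (integrable_of_continuous (μ : Measure Circle) hf)).symm
  rw [e]
  have h1 := hreal _ (Complex.continuous_re.comp hf)
  have h2 := hreal _ (Complex.continuous_im.comp hf)
  simp only [Function.comp_def] at h1 h2
  fun_prop

/-- **Verblunsky's theorem**, existence: every sequence in the open unit disc is the sequence of
Verblunsky coefficients of a nontrivial probability measure. -/
lemma exists_isNontrivial_verblunsky_eq {α : ℕ → ℂ} (hα : ∀ n, ‖α n‖ < 1) :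
    ∃ μ : Measure Circle, IsNontrivial μ ∧ ∀ n, verblunsky μ n = α n := by
  set K : ℕ → Set (ProbabilityMeasure Circle) := fun N => {μ | IsOrth (μ : Measure Circle) α N}
    with hK
  have hclosed : ∀ N, IsClosed (K N) := by
    intro N
    simp only [hK, IsOrth, Set.ofPred_forall]
    refine isClosed_iInter fun j => isClosed_iInter fun _ => isClosed_eq ?_ continuous_const
    exact continuous_integral_probabilityMeasure (continuous_ip_integrand _ _)
  -- The sets `K N` are nested by `IsOrth.of_succ`, nonempty by Bernstein–Szegő, and weakly closed
  -- in the compact space of probability measures on the circle.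
  obtain ⟨μ, hμ⟩ := IsCompact.nonempty_iInter_of_sequence_nonempty_isCompact_isClosed K
    (fun N μ hμ => IsOrth.of_succ (hα N) hμ)
    (fun N => by
      obtain ⟨μ, hμ, ho⟩ := exists_isProbabilityMeasure_isOrth hα N
      exact ⟨⟨μ, hμ⟩, ho⟩) (hclosed 0).isCompact hclosed
  exact ⟨μ, isNontrivial_of_isOrth hα fun n => Set.mem_iInter.mp hμ n⟩

/-! ### Verblunsky coefficients of `sin(θ/2)^{2b} dθ` -/

/-- The number `-b / (n + 1 + b)`. -/
def sinCoeff (b : ℝ) (n : ℕ) : ℝ := -b / (n + 1 + b)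

/-- The vanishing of the pairings of the Szegő polynomials with lower powers, when the moments
satisfy the hypergeometric recursion `(j + b) M j = (j - 1 - b) M (j - 1)`. -/
lemma szego_pairing_eq_zero {b : ℂ} (hb : ∀ k : ℤ, (k : ℂ) + b ≠ 0) {A B : ℕ → ℤ → ℂ}
    (hAB : ∀ j, A 0 j = B 0 j) (h0 : ∀ j : ℤ, (1 + b - j) * A 0 (j - 1) = -(j + b) * A 0 j)
    (hA : ∀ (n : ℕ) (j : ℤ), A (n + 1) j = A n (j - 1) - -b / (n + 1 + b) * B n j)
    (hB : ∀ (n : ℕ) (j : ℤ), B (n + 1) j = B n j - -b / (n + 1 + b) * A n (j - 1)) :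
    ∀ (n : ℕ) (j : ℤ), 0 ≤ j → j < n → A n j = 0 := by
  have hb1 : ∀ n : ℕ, (n + 1 + b : ℂ) ≠ 0 := fun n => by
    have := hb (n + 1); push_cast at this; exact this
  have hb2 : ∀ (n : ℕ) (j : ℤ), (n + 1 + b - j : ℂ) ≠ 0 := fun n j => by
    have := hb (n + 1 - j); push_cast at this
    rwa [show (n + 1 + b - j : ℂ) = n + 1 - j + b by ring]
  have stepA : ∀ (n : ℕ) (j : ℤ), (n + 1 + b - j) * A n (j - 1) = -(j + b) * B n j →
      -- The proportionality between A n (j-1) and B n j collapses the two terms of the recursion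
      -- into one multiple of B n j.
      A (n + 1) j * ((n + 1 + b) * (n + 1 + b - j)) = -j * (n + 1 + 2 * b) * B n j := by
    intro n j h
    rw [hA]
    have := hb1 n
    field_simp
    linear_combination (n + 1 + b) * h
  have stepB : ∀ (n : ℕ) (j : ℤ), (n + 1 + b - j) * A n (j - 1) = -(j + b) * B n j →
      B (n + 1) j * ((n + 1 + b) * (n + 1 + b - j)) = (n + 1 - j) * (n + 1 + 2 * b) * B n j := by
    intro n j h
    rw [hB]
    have := hb1 n
    field_simp
    linear_combination b * h
  -- The first relation extends `h0` to all n. Its inductive step compares B n (j-1) with B n j, so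
  -- the second relation is carried along. In the third, the new index j = n+1 is killed by the
  -- factor n+1-j of `stepB`; the factor -j of `stepA` later settles j = 0.
  have main : ∀ (n : ℕ) (j : ℤ), (n + 1 + b - j) * A n (j - 1) = -(j + b) * B n j ∧
      (n + 1 - j) * (j + b) * B n j = (j - 1) * (n + 1 + b - j) * B n (j - 1) ∧
      (1 ≤ j → j ≤ n → B n j = 0) := by
    intro n
    induction n with
    | zero =>
      intro j
      refine ⟨?_, ?_, fun h1 h2 => by simp at h2; lia⟩
      · rw [← hAB]; simpa using h0 j
      · rw [← hAB, ← hAB]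
        push_cast
        linear_combination (1 - (j : ℂ)) * h0 j
    | succ n ih =>
      intro j
      have hne : ((n + 1 + b) * (n + 1 + b - j) : ℂ) ≠ 0 := mul_ne_zero (hb1 n) (hb2 n j)
      have S := (ih j).2.1
      have hBj := stepB n j (ih j).1
      have hA1 := stepA n (j - 1) (ih (j - 1)).1
      have hB1 := stepB n (j - 1) (ih (j - 1)).1
      push_cast at hA1 hB1 ⊢
      refine ⟨?_, ?_, fun h1 h2 => ?_⟩
      · apply mul_left_cancel₀ hne
        linear_combination (n + 1 + b - j) * hA1 + (j + b) * hBj + (n + 1 + 2 * b) * S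
      · apply mul_left_cancel₀ hne
        linear_combination (n + 2 - j) * (j + b) * hBj - (j - 1) * (n + 1 + b - j) * hB1
          + (n + 2 - j) * (n + 1 + 2 * b) * S
      · apply mul_right_cancel₀ hne
        rw [hBj, zero_mul]
        rcases h2.lt_or_eq with h2 | rfl
        · rw [(ih j).2.2 h1 (by lia), mul_zero]
        · push_cast; ring
  intro n j hj hjn
  rcases n with _ | n
  · simp at hjn; lia
  · have hne : ((n + 1 + b) * (n + 1 + b - j) : ℂ) ≠ 0 := mul_ne_zero (hb1 n) (hb2 n j)
    apply mul_right_cancel₀ hne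
    rw [stepA n j (main n j).1, zero_mul]
    rcases hj.lt_or_eq with hj | rfl
    · rw [(main n j).2.2 (by lia) (by push_cast at hjn; lia), mul_zero]
    · simp

/-- On [0, π] one has sin(θ/2) ≥ θ/π, and the exponent is negative, so (θ/π)^(2b) dominates; it is
integrable since 2b > -1. The reflection θ ↦ 2π - θ gives the other half. -/
lemma intervalIntegrable_sin_rpow {b : ℝ} (hb : -(1 / 2) < b) (hb0 : b < 0) :
    IntervalIntegrable (fun θ : ℝ => Real.sin (θ / 2) ^ (2 * b)) volume 0 (2 * Real.pi) := by
  have hpi := Real.pi_pos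
  have h1 : IntervalIntegrable (fun θ : ℝ => Real.sin (θ / 2) ^ (2 * b)) volume 0 Real.pi := by
    have hg : IntervalIntegrable (fun θ : ℝ => (Real.pi⁻¹) ^ (2 * b) * θ ^ (2 * b)) volume
        0 Real.pi :=
      (intervalIntegral.intervalIntegrable_rpow' (by linarith)).const_mul _
    refine hg.mono_fun ((Real.measurable_sin.comp
      (measurable_id.div_const 2)).pow_const _).aestronglyMeasurable ?_
    refine (ae_restrict_iff' measurableSet_uIoc).mpr (Eventually.of_forall fun θ hθ => ?_)
    rw [Set.uIoc_of_le hpi.le] at hθ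
    have hs : Real.pi⁻¹ * θ ≤ Real.sin (θ / 2) := by
      have := Real.mul_le_sin (x := θ / 2) (by linarith [hθ.1]) (by linarith [hθ.2])
      calc Real.pi⁻¹ * θ = 2 / Real.pi * (θ / 2) := by field_simp
        _ ≤ _ := this
    have h0 : 0 < Real.pi⁻¹ * θ := mul_pos (inv_pos.mpr hpi) hθ.1
    beta_reduce
    rw [← Real.mul_rpow (inv_pos.mpr hpi).le hθ.1.le, Real.norm_of_nonneg (Real.rpow_nonneg
      (h0.le.trans hs) _), Real.norm_of_nonneg (Real.rpow_nonneg h0.le _)]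
    exact Real.rpow_le_rpow_of_nonpos h0 hs (by linarith)
  have h2 := h1.comp_sub_left (2 * Real.pi)
  have e : (fun θ : ℝ => Real.sin ((2 * Real.pi - θ) / 2) ^ (2 * b)) =
      fun θ : ℝ => Real.sin (θ / 2) ^ (2 * b) := by
    ext θ
    rw [show (2 * Real.pi - θ) / 2 = Real.pi - θ / 2 by ring, Real.sin_pi_sub]
  rw [e, show 2 * Real.pi - 0 = 2 * Real.pi by ring, show 2 * Real.pi - Real.pi = Real.pi by ring]
    at h2
  exact h1.trans h2.symm

lemma sin_half_nonneg {θ : ℝ} (hθ : θ ∈ Set.Icc 0 (2 * Real.pi)) : 0 ≤ Real.sin (θ / 2) :=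
  Real.sin_nonneg_of_nonneg_of_le_pi (by linarith [hθ.1]) (by linarith [hθ.2])

lemma sin_half_pos {θ : ℝ} (hθ : θ ∈ Set.Ioo 0 (2 * Real.pi)) : 0 < Real.sin (θ / 2) :=
  Real.sin_pos_of_pos_of_lt_pi (by linarith [hθ.1]) (by linarith [hθ.2])

lemma integral_sin_rpow_pos {b : ℝ} (hb : -(1 / 2) < b) (hb0 : b < 0) :
    0 < ∫ θ in (0 : ℝ)..(2 * Real.pi), Real.sin (θ / 2) ^ (2 * b) :=
  intervalIntegral.intervalIntegral_pos_of_pos_on (intervalIntegrable_sin_rpow hb hb0)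
    (fun _ hθ => Real.rpow_pos_of_pos (sin_half_pos hθ) _) Real.two_pi_pos

/-- The unnormalized pairing of `p` with `z^j` in `L²(sin(θ/2)^{2b} dθ)`. -/
def sinPairing (b : ℝ) (p : ℂ[X]) (j : ℤ) : ℂ :=
  ∫ θ in (0 : ℝ)..(2 * Real.pi), ((Real.sin (θ / 2) ^ (2 * b) : ℝ) : ℂ) *
    (Complex.exp (-(j * θ * Complex.I)) * p.eval (Complex.exp (θ * Complex.I)))

lemma intervalIntegrable_sin_mul {b : ℝ} (hb : -(1 / 2) < b) (hb0 : b < 0) {g : ℝ → ℂ}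
    (hg : Continuous g) :
    IntervalIntegrable (fun θ : ℝ => ((Real.sin (θ / 2) ^ (2 * b) : ℝ) : ℂ) * g θ) volume
      0 (2 * Real.pi) :=
  have h := intervalIntegrable_sin_rpow hb hb0
  IntervalIntegrable.mul_continuousOn ⟨h.1.ofReal, h.2.ofReal⟩ hg.continuousOn

lemma continuous_sinPairing_aux (p : ℂ[X]) (j : ℤ) : Continuous fun θ : ℝ =>
    Complex.exp (-(j * θ * Complex.I)) * p.eval (Complex.exp (θ * Complex.I)) :=
  (by fun_prop : Continuous fun θ : ℝ => Complex.exp (-(j * θ * Complex.I))).mul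
    (p.continuous.comp (by fun_prop))

lemma sinPairing_sub {b : ℝ} (hb : -(1 / 2) < b) (hb0 : b < 0) (p q : ℂ[X]) (j : ℤ) :
    sinPairing b (p - q) j = sinPairing b p j - sinPairing b q j := by
  unfold sinPairing
  rw [← intervalIntegral.integral_sub
    (intervalIntegrable_sin_mul hb hb0 (continuous_sinPairing_aux p j))
    (intervalIntegrable_sin_mul hb hb0 (continuous_sinPairing_aux q j))]
  congr 1
  ext θ
  rw [eval_sub]; ring

lemma sinPairing_C_mul (b : ℝ) (c : ℂ) (p : ℂ[X]) (j : ℤ) :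
    sinPairing b (C c * p) j = c * sinPairing b p j := by
  unfold sinPairing
  rw [← intervalIntegral.integral_const_mul]
  congr 1
  ext θ
  rw [eval_mul, eval_C]; ring

lemma sinPairing_X_mul (b : ℝ) (p : ℂ[X]) (j : ℤ) :
    sinPairing b (X * p) j = sinPairing b p (j - 1) := by
  unfold sinPairing
  congr 1
  ext θ
  have : Complex.exp (-(((j - 1 : ℤ) : ℂ) * θ * Complex.I)) =
      Complex.exp (-(j * θ * Complex.I)) * Complex.exp (θ * Complex.I) := by
    rw [← Complex.exp_add]; congr 1; push_cast; ring
  rw [this, eval_mul, eval_X]; ring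

/-- The recursion of the moments of `sin(θ/2)^{2b} dθ`. -/
lemma sinPairing_one_recursion {b : ℝ} (hb : -(1 / 2) < b) (hb0 : b < 0) (j : ℤ) :
    (1 + b - j) * sinPairing b 1 (j - 1) = -(j + b) * sinPairing b 1 j := by
  set F : ℝ → ℂ := fun θ => ((Real.sin (θ / 2) ^ (2 * b + 1) : ℝ) : ℂ) *
    Complex.exp (-((j - 1 / 2) * θ * Complex.I)) with hF
  set G : ℝ → ℂ := fun θ => (1 + b - j) / 2 * (Complex.exp (-(((j - 1 : ℤ) : ℂ) * θ * Complex.I)) *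
      (1 : ℂ[X]).eval (Complex.exp (θ * Complex.I))) +
    (j + b) / 2 * (Complex.exp (-(j * θ * Complex.I)) *
      (1 : ℂ[X]).eval (Complex.exp (θ * Complex.I))) with hG
  have hGc : Continuous G := (continuous_const.mul (continuous_sinPairing_aux 1 (j - 1))).add
    (continuous_const.mul (continuous_sinPairing_aux 1 j))
  -- G is F' divided by the weight, with sine and cosine written as exponentials. F is continuous up
  -- to the endpoints and vanishes there because 2b+1 > 0.
  have hftc : ∫ θ in (0 : ℝ)..(2 * Real.pi), ((Real.sin (θ / 2) ^ (2 * b) : ℝ) : ℂ) * G θ =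
      F (2 * Real.pi) - F 0 := by
    refine intervalIntegral.integral_eq_sub_of_hasDerivAt_of_le Real.two_pi_pos.le ?_ ?_
      (intervalIntegrable_sin_mul hb hb0 hGc)
    · refine (Continuous.mul (Complex.continuous_ofReal.comp ?_) (by fun_prop)).continuousOn
      exact Continuous.rpow_const (by fun_prop) fun θ => Or.inr (by linarith)
    · intro θ hθ
      have hs := sin_half_pos hθ
      have d1 : HasDerivAt (fun θ : ℝ => Real.sin (θ / 2) ^ (2 * b + 1))
          (Real.cos (θ / 2) * (1 / 2) * (2 * b + 1) * Real.sin (θ / 2) ^ (2 * b + 1 - 1)) θ :=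
        ((hasDerivAt_id θ).div_const 2).sin.rpow_const (Or.inl hs.ne')
      have d2 : HasDerivAt (fun θ : ℝ => Complex.exp (-((j - 1 / 2) * θ * Complex.I)))
          (Complex.exp (-((j - 1 / 2) * θ * Complex.I)) * (-((j - 1 / 2) * 1 * Complex.I))) θ :=
        ((((hasDerivAt_id θ).ofReal_comp.const_mul (j - 1 / 2 : ℂ)).mul_const
          Complex.I).neg).cexp
      refine (d1.ofReal_comp.mul d2).congr_deriv ?_
      symm
      have e1 : Complex.exp (-(((j - 1 : ℤ) : ℂ) * θ * Complex.I)) =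
          Complex.exp (-((j - 1 / 2) * θ * Complex.I)) * Complex.exp (((θ / 2 : ℝ) : ℂ) * Complex.I) := by
        rw [← Complex.exp_add]; congr 1; push_cast; ring
      have e2 : Complex.exp (-(j * θ * Complex.I)) =
          Complex.exp (-((j - 1 / 2) * θ * Complex.I)) *
            Complex.exp (-((θ / 2 : ℝ) : ℂ) * Complex.I) := by
        rw [← Complex.exp_add]; congr 1; push_cast; ring
      have e3 : Real.sin (θ / 2) ^ (2 * b + 1) = Real.sin (θ / 2) ^ (2 * b) * Real.sin (θ / 2) := by
        rw [Real.rpow_add hs, Real.rpow_one]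
      simp only [hG, eval_one, mul_one]
      rw [e1, e2, e3, Complex.exp_mul_I, Complex.exp_mul_I, Complex.cos_neg, Complex.sin_neg,
        ← Complex.ofReal_cos, ← Complex.ofReal_sin, add_sub_cancel_right]
      push_cast
      ring
  have hz : F (2 * Real.pi) - F 0 = 0 := by
    have : (2 * b + 1) ≠ 0 := by linarith
    simp [hF, Real.zero_rpow this]
  rw [hz] at hftc
  have hsplit : ∫ θ in (0 : ℝ)..(2 * Real.pi), ((Real.sin (θ / 2) ^ (2 * b) : ℝ) : ℂ) * G θ =
      (1 + b - j) / 2 * sinPairing b 1 (j - 1) + (j + b) / 2 * sinPairing b 1 j := by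
    unfold sinPairing
    rw [← intervalIntegral.integral_const_mul, ← intervalIntegral.integral_const_mul,
      ← intervalIntegral.integral_add
        ((intervalIntegrable_sin_mul hb hb0 (continuous_sinPairing_aux 1 (j - 1))).const_mul _)
        ((intervalIntegrable_sin_mul hb hb0 (continuous_sinPairing_aux 1 j)).const_mul _)]
    congr 1
    ext θ
    simp only [hG]
    ring
  rw [hsplit] at hftc
  linear_combination 2 * hftc

lemma sinCoeff_den_pos {b : ℝ} (hb : -(1 / 2) < b) (n : ℕ) : 0 < (n : ℝ) + 1 + b := by
  have : (0 : ℝ) ≤ n := n.cast_nonneg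
  linarith

lemma sinPairing_szegoPoly {b : ℝ} (hb : -(1 / 2) < b) (hb0 : b < 0) {n j : ℕ} (hj : j < n) :
    sinPairing b (szegoPoly (fun n => (sinCoeff b n : ℂ)) n) j = 0 := by
  refine szego_pairing_eq_zero (b := (b : ℂ)) ?_ (A := fun n j => sinPairing b
    (szegoPoly (fun n => (sinCoeff b n : ℂ)) n) j) (B := fun n j => sinPairing b
    (szegoDual (fun n => (sinCoeff b n : ℂ)) n) j) (fun j => rfl)
    (fun j => sinPairing_one_recursion hb hb0 j) (fun n j => ?_) (fun n j => ?_) n j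
    (by positivity) (by exact_mod_cast hj)
  · intro k hk
    have hk' : (k : ℝ) + b = 0 := by exact_mod_cast hk
    have h1 : (0 : ℝ) < k := by linarith
    have h2 : (k : ℝ) < 1 := by linarith
    norm_cast at h1 h2
    lia
  · simp only [szegoPoly_succ, sinPairing_sub hb hb0, sinPairing_C_mul, sinPairing_X_mul]
    simp [sinCoeff]
  · simp only [szegoDual_succ, sinPairing_sub hb hb0, sinPairing_C_mul, sinPairing_X_mul]
    simp [sinCoeff]

lemma sinCoeff_pos {b : ℝ} (hb : -(1 / 2) < b) (hb0 : b < 0) (n : ℕ) : 0 < sinCoeff b n :=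
  div_pos (by linarith) (sinCoeff_den_pos hb n)

lemma sinCoeff_lt_one {b : ℝ} (hb : -(1 / 2) < b) (n : ℕ) : sinCoeff b n < 1 := by
  rw [sinCoeff, div_lt_one (sinCoeff_den_pos hb n)]
  have : (0 : ℝ) ≤ n := n.cast_nonneg
  linarith

/-- The measure `τ sin(θ/2)^{2b} dθ` is nontrivial, with Verblunsky coefficients
`-b / (n + 1 + b)`. -/
lemma sinMeasure_isNontrivial {b : ℝ} (hb : -(1 / 2) < b) (hb0 : b < 0) :
    IsNontrivial (sinMeasure b) ∧ ∀ n, verblunsky (sinMeasure b) n = sinCoeff b n := by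
  have hI := integral_sin_rpow_pos hb hb0
  have htau : 0 < tau b := inv_pos.mpr hI
  have hint : IntervalIntegrable (fun θ => tau b * Real.sin (θ / 2) ^ (2 * b)) volume
      0 (2 * Real.pi) := (intervalIntegrable_sin_rpow hb hb0).const_mul _
  have hnn : ∀ θ ∈ Set.Icc 0 (2 * Real.pi), 0 ≤ tau b * Real.sin (θ / 2) ^ (2 * b) :=
    fun θ hθ => mul_nonneg htau.le (Real.rpow_nonneg (sin_half_nonneg hθ) _)
  have e : sinMeasure b = densityMeasure fun θ => tau b * Real.sin (θ / 2) ^ (2 * b) := rfl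
  have : IsProbabilityMeasure (sinMeasure b) := by
    rw [e]
    refine isProbabilityMeasure_densityMeasure hint hnn ?_
    rw [intervalIntegral.integral_const_mul, tau, inv_mul_cancel₀ hI.ne']
  refine isNontrivial_of_isOrth (α := fun n => (sinCoeff b n : ℂ)) (fun n => ?_) fun n j hj => ?_
  · rw [Complex.norm_real, Real.norm_of_nonneg (sinCoeff_pos hb hb0 n).le]
    exact sinCoeff_lt_one hb n
  · rw [ip, e, integral_densityMeasure hint hnn (continuous_ip_integrand _ _)]
    have h := sinPairing_szegoPoly hb hb0 hj
    rw [← mul_zero (tau b : ℂ), ← h, sinPairing, ← intervalIntegral.integral_const_mul]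
    congr 1
    ext θ
    rw [eval_pow, eval_X, Circle.coe_exp, map_pow, ← Complex.exp_conj, ← Complex.exp_nat_mul]
    simp only [map_mul, Complex.conj_ofReal, Complex.conj_I]
    push_cast
    rw [show ((j : ℂ) * (θ * -Complex.I)) = -(j * θ * Complex.I) by ring]
    ring

/-! ### Boundedness and summation by parts -/

/-- Summation by parts: `∑ c_n w^n` converges when `c` has bounded variation and tends to `0`. -/
lemma exists_tendsto_sum_mul_pow {c : ℕ → ℂ} (hc : Tendsto c atTop (𝓝 0))
    (hv : Summable fun n => ‖c (n + 1) - c n‖) {w : ℂ} (hw : ‖w‖ = 1) (hw1 : w ≠ 1) :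
    ∃ l, Tendsto (fun N => ∑ n ∈ Finset.range N, c n * w ^ n) atTop (𝓝 l) := by
  have hne : (1 - w) ≠ 0 := sub_ne_zero.mpr hw1.symm
  have hparts : ∀ N, ∑ n ∈ Finset.range N, c n * w ^ n = (1 - w)⁻¹ *
      (c 0 - c N * w ^ N + ∑ n ∈ Finset.range N, (c (n + 1) - c n) * w ^ (n + 1)) := by
    intro N
    rw [eq_inv_mul_iff_mul_eq₀ hne]
    induction N with
    | zero => simp
    | succ N ih =>
      rw [Finset.sum_range_succ, Finset.sum_range_succ, mul_add, ih]
      ring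
  have hsum : Summable fun n => (c (n + 1) - c n) * w ^ (n + 1) :=
    Summable.of_norm (by simpa [hw] using hv)
  have hcw : Tendsto (fun N => c N * w ^ N) atTop (𝓝 0) := by
    rw [tendsto_zero_iff_norm_tendsto_zero] at hc ⊢
    simpa [hw] using hc
  simp_rw [hparts]
  exact ⟨_, ((tendsto_const_nhds.sub hcw).add hsum.hasSum.tendsto_sum_nat).const_mul _⟩

/-- A discrete Grönwall inequality. -/
lemma exists_bound_of_gronwall {M d e : ℕ → ℝ} {N : ℕ} (hM : ∀ n, 0 ≤ M n) (hd : ∀ n, 0 ≤ d n)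
    (he : ∀ n, 0 ≤ e n) (hsum : Summable e) (hMd : ∀ n ≥ N, M n ≤ 2 * d n)
    (hstep : ∀ n, d (n + 1) ≤ d n + e n * M n) : ∃ K, ∀ n, M n ≤ K := by
  have key : ∀ n ≥ N, d n ≤ d N * Real.exp (2 * ∑ k ∈ Finset.range n, e k) := by
    intro n hn
    induction n, hn using Nat.le_induction with
    | base =>
      exact le_mul_of_one_le_right (hd N)
        (Real.one_le_exp (mul_nonneg zero_le_two (Finset.sum_nonneg fun k _ => he k)))
    | succ n hn ih =>
      rw [Finset.sum_range_succ, mul_add, Real.exp_add, ← mul_assoc]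
      calc d (n + 1) ≤ d n + e n * M n := hstep n
        _ ≤ d n + e n * (2 * d n) := by gcongr; exacts [he n, hMd n hn]
        _ = d n * (2 * e n + 1) := by ring
        _ ≤ d n * Real.exp (2 * e n) := by gcongr; exacts [hd n, Real.add_one_le_exp _]
        _ ≤ _ := by gcongr
  -- The second summand covers the finitely many indices below N, where M is not controlled by d.
  refine ⟨2 * (d N * Real.exp (2 * ∑' k, e k)) + ∑ k ∈ Finset.range N, M k, fun n => ?_⟩
  have h1 : 0 ≤ 2 * (d N * Real.exp (2 * ∑' k, e k)) := by have := hd N; positivity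
  have h2 : 0 ≤ ∑ k ∈ Finset.range N, M k := Finset.sum_nonneg fun k _ => hM k
  rcases lt_or_ge n N with hn | hn
  · have := Finset.single_le_sum (f := M) (fun k _ => hM k) (Finset.mem_range.mpr hn)
    linarith
  · have h3 : d N * Real.exp (2 * ∑ k ∈ Finset.range n, e k) ≤
        d N * Real.exp (2 * ∑' k, e k) := by
      gcongr
      · exact hd N
      · exact hsum.sum_le_tsum _ fun k _ => he k
    linarith [hMd n hn, key n hn]

lemma summable_sub_succ_of_antitone {a : ℕ → ℝ} (ha : ∀ n, 0 ≤ a n) (hanti : Antitone a) :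
    Summable fun n => a n - a (n + 1) := by
  refine summable_of_sum_range_le (c := a 0) (fun n => sub_nonneg.mpr (hanti n.le_succ)) fun n => ?_
  rw [Finset.sum_range_sub']
  linarith [ha n]

/-- The rotated value `w^{-n} Φ_n(w)`. -/
def rotated (α : ℕ → ℂ) (w : Circle) (n : ℕ) : ℂ :=
  conj (w : ℂ) ^ n * (szegoPoly α n).eval (w : ℂ)

lemma circle_conj_pow_mul (w : Circle) (n : ℕ) : conj (w : ℂ) ^ n * (w : ℂ) ^ n = 1 := by
  rw [← mul_pow, circle_conj_mul, one_pow]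

lemma eval_szegoPoly_eq_rotated (α : ℕ → ℂ) (w : Circle) (n : ℕ) :
    (szegoPoly α n).eval (w : ℂ) = rotated α w n * (w : ℂ) ^ n := by
  rw [rotated]
  linear_combination -(szegoPoly α n).eval (w : ℂ) * circle_conj_pow_mul w n

lemma norm_rotated (α : ℕ → ℂ) (w : Circle) (n : ℕ) :
    ‖rotated α w n‖ = ‖(szegoPoly α n).eval (w : ℂ)‖ := by
  simp [rotated, norm_pow, Circle.norm_coe]

lemma norm_szegoDual_eval_circle (α : ℕ → ℂ) (w : Circle) (n : ℕ) :
    ‖(szegoDual α n).eval (w : ℂ)‖ = ‖rotated α w n‖ := by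
  rw [norm_rotated, szegoDual_eval_circle, norm_mul, norm_pow, Circle.norm_coe, one_pow, one_mul,
    RCLike.norm_conj]

lemma rotated_succ (α : ℕ → ℂ) (w : Circle) (n : ℕ) : rotated α w (n + 1) =
    rotated α w n - conj (α n) * conj (w : ℂ) ^ (n + 1) * (szegoDual α n).eval (w : ℂ) := by
  simp only [rotated, szegoPoly_succ, eval_sub, eval_mul, eval_X, eval_C, pow_succ]
  linear_combination (conj (w : ℂ) ^ n * eval (w : ℂ) (szegoPoly α n)) * circle_conj_mul w

lemma szegoDual_succ_eval (α : ℕ → ℂ) (w : Circle) (n : ℕ) : (szegoDual α (n + 1)).eval (w : ℂ) =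
    (szegoDual α n).eval (w : ℂ) - α n * (w : ℂ) ^ (n + 1) * rotated α w n := by
  simp only [szegoDual_succ, eval_sub, eval_mul, eval_X, eval_C, eval_szegoPoly_eq_rotated]
  ring

lemma circle_one_sub_conj_ne_zero {w : Circle} (hw : w ≠ 1) : 1 - conj (w : ℂ) ≠ 0 := by
  intro h
  apply hw
  have h' : conj (w : ℂ) = 1 := (sub_eq_zero.mp h).symm
  have := congrArg conj h'
  rw [Complex.conj_conj, map_one] at this
  exact Circle.ext (by simpa using this)

/-- Szegő polynomials with monotone square-summable coefficients of constant phase are bounded at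
every point of the circle other than `1`. -/
lemma exists_bound_rotated {a : ℕ → ℝ} (ha : ∀ n, 0 ≤ a n) (hanti : Antitone a)
    (hsq : Summable fun n => a n ^ 2) (c : Circle) {w : Circle} (hw : w ≠ 1) :
    ∃ K, ∀ n, ‖rotated (fun n => (c : ℂ) * a n) w n‖ ≤ K := by
  set α : ℕ → ℂ := fun n => (c : ℂ) * a n with hα
  set s : ℂ := 1 - conj (w : ℂ) with hs
  have hs0 : s ≠ 0 := circle_one_sub_conj_ne_zero hw
  set κ : ℝ := ‖s‖⁻¹ with hκ
  have hκ0 : 0 < κ := inv_pos.mpr (norm_pos_iff.mpr hs0)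
  -- The increment of U contains conj(α_n) conj(w)^(n+1) V_n, whose size a_n|U_n| is not summable
  -- relative to |U_n|. By geometric summation in conj(w), g_n - g_{n+1} equals its coefficient up
  -- to O(a_n - a_{n+1}). Passing to D = U - gV therefore leaves only errors of relative size a_n -
  -- a_{n+1} and a_n a_{n+1}.
  set g : ℕ → ℂ := fun n => conj (c : ℂ) * a n * conj (w : ℂ) ^ (n + 1) / s with hg
  have hgn : ∀ n, ‖g n‖ = κ * a n := fun n => by
    simp only [hg, norm_div, norm_mul, norm_pow, RCLike.norm_conj, Circle.norm_coe,
      Complex.norm_real, Real.norm_of_nonneg (ha n), hκ]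
    ring
  set U := rotated α w with hU
  set V : ℕ → ℂ := fun n => (szegoDual α n).eval (w : ℂ) with hV
  have hVU : ∀ n, ‖V n‖ = ‖U n‖ := fun n => norm_szegoDual_eval_circle α w n
  set D : ℕ → ℂ := fun n => U n - g n * V n with hD
  have hgdiff : ∀ n, g n - g (n + 1) - conj (α n) * conj (w : ℂ) ^ (n + 1) =
      conj (c : ℂ) * conj (w : ℂ) ^ (n + 2) / s * ((a n - a (n + 1) : ℝ) : ℂ) := by
    intro n
    simp only [hg, hα, map_mul, Complex.conj_ofReal]
    field_simp
    push_cast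
    rw [hs]
    ring
  have hDdiff : ∀ n, D (n + 1) = D n +
      (conj (c : ℂ) * conj (w : ℂ) ^ (n + 2) / s * ((a n - a (n + 1) : ℝ) : ℂ) * V n +
        g (n + 1) * (α n * (w : ℂ) ^ (n + 1) * U n)) := by
    intro n
    rw [← hgdiff]
    simp only [hD, hU, hV, rotated_succ, szegoDual_succ_eval]
    ring
  set e : ℕ → ℝ := fun n => κ * (a n - a (n + 1)) + κ * a n ^ 2 with he
  have hsub : ∀ n, 0 ≤ a n - a (n + 1) := fun n => sub_nonneg.mpr (hanti n.le_succ)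
  have hlim : Tendsto a atTop (𝓝 0) := by
    have := hsq.tendsto_atTop_zero.sqrt
    simpa [Real.sqrt_sq (ha _)] using this
  -- Once |g_n| ≤ 1/2, |V_n| = |U_n| gives |U_n| ≤ 2|D_n|, as Grönwall needs.
  obtain ⟨N, hN⟩ : ∃ N, ∀ n ≥ N, κ * a n ≤ 1 / 2 := by
    have : Tendsto (fun n => κ * a n) atTop (𝓝 0) := by simpa using hlim.const_mul κ
    exact eventually_atTop.mp (this.eventually_le_const (by norm_num))
  refine exists_bound_of_gronwall (d := fun n => ‖D n‖) (e := e) (N := N) (fun n => norm_nonneg _)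
    (fun n => norm_nonneg _) (fun n => ?_) ?_ (fun n hn => ?_) fun n => ?_
  · have := hsub n; positivity
  · exact ((summable_sub_succ_of_antitone ha hanti).mul_left κ).add (hsq.mul_left κ)
  · have h1 : ‖U n‖ ≤ ‖D n‖ + ‖g n * V n‖ := by
      calc ‖U n‖ = ‖D n + g n * V n‖ := by simp [hD]
        _ ≤ _ := norm_add_le _ _
    rw [norm_mul, hgn, hVU] at h1
    nlinarith [hN n hn, norm_nonneg (U n)]
  · rw [hDdiff]
    refine (norm_add_le _ _).trans (add_le_add le_rfl ((norm_add_le _ _).trans ?_))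
    have hαn : ‖α n‖ = a n := by simp [hα, Real.norm_of_nonneg (ha n), Circle.norm_coe]
    have t1 : ‖conj (c : ℂ) * conj (w : ℂ) ^ (n + 2) / s * ((a n - a (n + 1) : ℝ) : ℂ) * V n‖ =
        κ * (a n - a (n + 1)) * ‖U n‖ := by
      rw [norm_mul, norm_mul, norm_div, norm_mul, norm_pow, RCLike.norm_conj, RCLike.norm_conj,
        Circle.norm_coe, Circle.norm_coe, Complex.norm_real, Real.norm_of_nonneg (hsub n), hVU]
      simp [hκ]
    have t2 : ‖g (n + 1) * (α n * (w : ℂ) ^ (n + 1) * U n)‖ = κ * (a (n + 1) * a n) * ‖U n‖ := by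
      rw [norm_mul, norm_mul, norm_mul, norm_pow, Circle.norm_coe, hgn, hαn]
      ring
    rw [t1, t2, he]
    have h3 : a (n + 1) * a n ≤ a n ^ 2 := by
      rw [sq]; exact mul_le_mul_of_nonneg_right (hanti n.le_succ) (ha n)
    have h4 : κ * (a (n + 1) * a n) * ‖U n‖ ≤ κ * a n ^ 2 * ‖U n‖ := by gcongr
    linarith

/-- Convergence of `∑ q_n Φ_n(w)` with `q_n = ∏_{k<n} (1 + a_k)⁻¹`. -/
lemma exists_tendsto_sum_prod_inv_mul {a : ℕ → ℝ} (ha : ∀ n, 0 ≤ a n) (ha1 : ∀ n, a n ≤ 1)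
    (hanti : Antitone a) (hsq : Summable fun n => a n ^ 2) (hdiv : ¬ Summable a) (c : Circle)
    {w : Circle} (hw : w ≠ 1) :
    ∃ l, Tendsto (fun N => ∑ n ∈ Finset.range N,
      (((∏ k ∈ Finset.range n, (1 + a k))⁻¹ : ℝ) : ℂ) *
        (szegoPoly (fun n => (c : ℂ) * a n) n).eval (w : ℂ)) atTop (𝓝 l) := by
  obtain ⟨K, hK⟩ := exists_bound_rotated ha hanti hsq c hw
  set α : ℕ → ℂ := fun n => (c : ℂ) * a n with hα
  set P : ℕ → ℝ := fun n => ∏ k ∈ Finset.range n, (1 + a k) with hP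
  have hP0 : ∀ n, 0 < P n := fun n => Finset.prod_pos fun k _ => by linarith [ha k]
  have hPs : ∀ n, P (n + 1) = P n * (1 + a n) := fun n => Finset.prod_range_succ _ _
  set q : ℕ → ℝ := fun n => (P n)⁻¹ with hq
  have hq0 : ∀ n, 0 ≤ q n := fun n => (inv_pos.mpr (hP0 n)).le
  have hqs : ∀ n, q n = q (n + 1) * (1 + a n) := fun n => by
    have := ha n
    have := hP0 n
    simp only [hq, hPs]
    field_simp
  have hqanti : Antitone q := antitone_nat_of_succ_le fun n => by
    rw [hqs n]; nlinarith [hq0 (n + 1), ha n]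
  have hlim : Tendsto q atTop (𝓝 0) := by
    refine Tendsto.inv_tendsto_atTop (tendsto_atTop_mono (f := fun n =>
      ∑ k ∈ Finset.range n, a k) (fun n => ?_)
      ((not_summable_iff_tendsto_nat_atTop_of_nonneg ha).mp hdiv))
    have : 1 + ∑ k ∈ Finset.range n, a k ≤ P n := by
      induction n with
      | zero => simp [hP]
      | succ n ih =>
        rw [hPs, Finset.sum_range_succ]
        have : 0 ≤ ∑ k ∈ Finset.range n, a k := Finset.sum_nonneg fun k _ => ha k
        nlinarith [ha n]
    linarith
  have hKnn : 0 ≤ K := (norm_nonneg _).trans (hK 0)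
  have hc0 : Tendsto (fun n => (q n : ℂ) * rotated α w n) atTop (𝓝 0) := by
    rw [tendsto_zero_iff_norm_tendsto_zero]
    refine squeeze_zero (fun n => norm_nonneg _) (fun n => ?_)
      (by simpa using hlim.mul_const K : Tendsto (fun n => q n * K) atTop (𝓝 0))
    rw [norm_mul, Complex.norm_real, Real.norm_of_nonneg (hq0 n)]
    exact mul_le_mul_of_nonneg_left (hK n) (hq0 n)
  have hvar : Summable fun n => ‖(q (n + 1) : ℂ) * rotated α w (n + 1) - q n * rotated α w n‖ := by
    -- Of the constant 3K, one K comes from the increment of q and 2K from that of `rotated`: q_n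
    -- a_n = (1+a_n)(q_n - q_{n+1}) ≤ 2(q_n - q_{n+1}).
    refine Summable.of_nonneg_of_le (fun n => norm_nonneg _) (fun n => ?_)
      ((summable_sub_succ_of_antitone hq0 hqanti).mul_right (3 * K))
    have hr : ‖rotated α w (n + 1) - rotated α w n‖ ≤ a n * K := by
      have hαn : ‖α n‖ = a n := by simp [hα, Real.norm_of_nonneg (ha n), Circle.norm_coe]
      rw [rotated_succ, sub_sub_cancel_left, norm_neg, norm_mul, norm_mul, norm_pow,
        RCLike.norm_conj, RCLike.norm_conj, Circle.norm_coe, one_pow, mul_one, hαn,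
        norm_szegoDual_eval_circle]
      exact mul_le_mul_of_nonneg_left (hK n) (ha n)
    have hsubq : 0 ≤ q n - q (n + 1) := sub_nonneg.mpr (hqanti n.le_succ)
    have e : (q (n + 1) : ℂ) * rotated α w (n + 1) - q n * rotated α w n =
        -((q n - q (n + 1) : ℝ) : ℂ) * rotated α w (n + 1) +
          q n * (rotated α w (n + 1) - rotated α w n) := by
      push_cast; ring
    rw [e]
    refine (norm_add_le _ _).trans ?_
    rw [norm_mul, norm_mul, norm_neg, Complex.norm_real, Complex.norm_real,
      Real.norm_of_nonneg hsubq, Real.norm_of_nonneg (hq0 n)]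
    have h1 := mul_le_mul_of_nonneg_left (hK (n + 1)) hsubq
    have h2 := mul_le_mul_of_nonneg_left hr (hq0 n)
    have h3 : q n * a n ≤ 2 * (q n - q (n + 1)) := by
      have := mul_nonneg (mul_nonneg (hq0 (n + 1)) (ha n)) (sub_nonneg.mpr (ha1 n))
      rw [hqs n]; nlinarith
    have h4 := mul_le_mul_of_nonneg_right h3 hKnn
    linarith
  obtain ⟨l, hl⟩ := exists_tendsto_sum_mul_pow hc0 hvar w.norm_coe
    (fun h => hw (Circle.ext (by simpa using h)))
  refine ⟨l, hl.congr fun N => Finset.sum_congr rfl fun n _ => ?_⟩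
  rw [eval_szegoPoly_eq_rotated, mul_assoc]

/-! ### Conjugation symmetry -/

lemma szego_conj (α : ℕ → ℂ) (z : ℂ) (n : ℕ) :
    (szegoPoly (fun n => conj (α n)) n).eval (conj z) = conj ((szegoPoly α n).eval z) ∧
    (szegoDual (fun n => conj (α n)) n).eval (conj z) = conj ((szegoDual α n).eval z) := by
  induction n with
  | zero => simp
  | succ n ih => simp [szegoPoly_succ, szegoDual_succ, ih.1, ih.2]

/-! ### The coefficients `-b / (n + 1 + b)` -/

lemma sinCoeff_antitone {b : ℝ} (hb : -(1 / 2) < b) (hb0 : b < 0) : Antitone (sinCoeff b) := by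
  refine antitone_nat_of_succ_le fun n => ?_
  have := sinCoeff_den_pos hb n
  unfold sinCoeff
  gcongr
  · linarith
  · linarith

lemma sinCoeff_le {b : ℝ} (hb : -(1 / 2) < b) (n : ℕ) : sinCoeff b n ≤ 1 / (n + 1) := by
  have := sinCoeff_den_pos hb n
  have hn : (0 : ℝ) ≤ n := n.cast_nonneg
  rw [sinCoeff, div_le_div_iff₀ this (by positivity)]
  nlinarith

lemma summable_sinCoeff_sq {b : ℝ} (hb : -(1 / 2) < b) (hb0 : b < 0) :
    Summable fun n => sinCoeff b n ^ 2 := by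
  refine Summable.of_nonneg_of_le (fun n => sq_nonneg _) (fun n => ?_)
    ((summable_nat_add_iff 1).mpr (Real.summable_one_div_nat_pow.mpr one_lt_two))
  have h := pow_le_pow_left₀ (sinCoeff_pos hb hb0 n).le (sinCoeff_le hb n) 2
  rw [div_pow, one_pow] at h
  exact_mod_cast h

lemma not_summable_sinCoeff {b : ℝ} (hb : -(1 / 2) < b) (hb0 : b < 0) :
    ¬ Summable (sinCoeff b) := by
  intro h
  apply Real.not_summable_one_div_natCast
  rw [← summable_nat_add_iff 1]
  refine Summable.of_nonneg_of_le (fun n => by positivity) (fun n => ?_) (h.mul_left (-b)⁻¹)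
  have := sinCoeff_den_pos hb n
  rw [sinCoeff, ← mul_div_assoc, inv_mul_cancel₀ (by linarith)]
  push_cast
  exact one_div_le_one_div_of_le this (by linarith)

/-- The squared norms of the monic polynomials are bounded below. -/
lemma exists_pos_le_prod_sinCoeff {b : ℝ} (hb : -(1 / 2) < b) (hb0 : b < 0) :
    ∃ c > 0, ∀ n, c ≤ ∏ k ∈ Finset.range n, (1 - sinCoeff b k ^ 2) := by
  have hpos : ∀ k, 0 < 1 - sinCoeff b k ^ 2 := fun k => by
    nlinarith [sinCoeff_pos hb hb0 k, sinCoeff_lt_one hb k]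
  set c := (1 - sinCoeff b 0 ^ 2) / 2 with hc
  have hc0 : 0 < c := half_pos (hpos 0)
  -- The factors with k ≥ 1 are at least 1 - 1/(k+1)², whose product telescopes to (n+2)/(2(n+1)).
  -- For k = 0 that bound is 0, so the exact factor is kept in c.
  have key : ∀ n : ℕ, c * ((n + 2) / (n + 1)) ≤
      ∏ k ∈ Finset.range (n + 1), (1 - sinCoeff b k ^ 2) := by
    intro n
    induction n with
    | zero => simp [hc]
    | succ n ih =>
      rw [Finset.prod_range_succ]
      have h1 := pow_le_pow_left₀ (sinCoeff_pos hb hb0 (n + 1)).le (sinCoeff_le hb (n + 1)) 2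
      push_cast at h1 ⊢
      calc c * ((n + 1 + 2) / (n + 1 + 1)) =
          c * ((n + 2) / (n + 1)) * (1 - (1 / ((n : ℝ) + 1 + 1)) ^ 2) := by
            field_simp; ring
        _ ≤ c * ((n + 2) / (n + 1)) * (1 - sinCoeff b (n + 1) ^ 2) := by gcongr
        _ ≤ _ := mul_le_mul_of_nonneg_right ih (hpos _).le
  refine ⟨c, hc0, fun n => ?_⟩
  rcases n with _ | n
  · simp only [Finset.range_zero, Finset.prod_empty, hc]
    nlinarith [sq_nonneg (sinCoeff b 0)]
  · refine le_trans ?_ (key n)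
    refine le_mul_of_one_le_right hc0.le ?_
    rw [one_le_div (by positivity)]
    linarith

/-! ### The orthonormal polynomials of the Alexandrov measures -/

lemma norm_circle_mul_sinCoeff {b : ℝ} (hb : -(1 / 2) < b) (hb0 : b < 0) (c : Circle) (n : ℕ) :
    ‖(c : ℂ) * sinCoeff b n‖ = sinCoeff b n := by
  rw [norm_mul, Circle.norm_coe, one_mul, Complex.norm_real,
    Real.norm_of_nonneg (sinCoeff_pos hb hb0 n).le]

lemma normProd_circle_mul_sinCoeff {b : ℝ} (hb : -(1 / 2) < b) (hb0 : b < 0) (c : Circle)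
    (n : ℕ) : normProd (fun n => (c : ℂ) * sinCoeff b n) n =
      ∏ k ∈ Finset.range n, (1 - sinCoeff b k ^ 2) := by
  simp only [normProd, norm_circle_mul_sinCoeff hb hb0]

lemma sinMeasure_isAlexandrov_one {b : ℝ} (hb : -(1 / 2) < b) (hb0 : b < 0) :
    IsAlexandrov (sinMeasure b) 1 (sinMeasure b) :=
  ⟨(sinMeasure_isNontrivial hb hb0).1, fun n => by simp⟩

lemma exists_isAlexandrov {b : ℝ} (hb : -(1 / 2) < b) (hb0 : b < 0) (c : Circle) :
    ∃ ν, IsAlexandrov (sinMeasure b) c ν := by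
  obtain ⟨ν, hν, hν'⟩ := exists_isNontrivial_verblunsky_eq
    (α := fun n => (c : ℂ) * sinCoeff b n) fun n => by
      rw [norm_circle_mul_sinCoeff hb hb0]; exact sinCoeff_lt_one hb n
  exact ⟨ν, hν, fun n => by rw [hν', (sinMeasure_isNontrivial hb hb0).2]⟩

lemma IsAlexandrov.opVec_eq {b : ℝ} (hb : -(1 / 2) < b) (hb0 : b < 0) {c : Circle}
    {ν : Measure Circle} (hν : IsAlexandrov (sinMeasure b) c ν) (w : Circle) (n : ℕ) :
    opVec ν w n = (((Real.sqrt (∏ k ∈ Finset.range n, (1 - sinCoeff b k ^ 2)))⁻¹ : ℝ) : ℂ) *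
      (szegoPoly (fun n => (c : ℂ) * sinCoeff b n) n).eval (w : ℂ) := by
  rw [OPUC.opVec_eq hν.isNontrivial (α := fun n => (c : ℂ) * sinCoeff b n)
    (fun n => by rw [hν.verblunsky_eq, (sinMeasure_isNontrivial hb hb0).2]),
    normProd_circle_mul_sinCoeff hb hb0]

lemma IsAlexandrov.memℓp_opFamily {b : ℝ} (hb : -(1 / 2) < b) (hb0 : b < 0) {c : Circle}
    {ν : Measure Circle} (hν : IsAlexandrov (sinMeasure b) c ν) (w : {w : Circle // w ≠ 1}) :
    Memℓp (opFamily ν w) ⊤ := by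
  obtain ⟨K, hK⟩ := exists_bound_rotated (fun n => (sinCoeff_pos hb hb0 n).le)
    (sinCoeff_antitone hb hb0) (summable_sinCoeff_sq hb hb0) c w.2
  obtain ⟨m, hm, hmP⟩ := exists_pos_le_prod_sinCoeff hb hb0
  refine memℓp_infty ⟨(Real.sqrt m)⁻¹ * K, ?_⟩
  rintro _ ⟨n, rfl⟩
  have hk := hK n
  rw [norm_rotated] at hk
  simp only [opFamily]
  rw [hν.opVec_eq hb hb0, norm_mul, Complex.norm_real, Real.norm_of_nonneg (by positivity)]
  have : 0 < Real.sqrt m := Real.sqrt_pos.mpr hm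
  gcongr
  exact hmP n

lemma not_countable_ne_one : ¬ Countable {w : Circle // w ≠ 1} := by
  intro h
  have h1 : ({w : Circle | w ≠ 1} ∪ {1}).Countable :=
    (Set.countable_coe_iff.mp h).union (Set.countable_singleton 1)
  have h2 : (Set.Ioc (-Real.pi) Real.pi).Countable := by
    refine (h1.image fun z : Circle => Complex.arg z).mono fun x hx => ?_
    exact ⟨Circle.exp x, by by_cases h : Circle.exp x = 1 <;> simp [h],
      Circle.arg_exp hx.1 hx.2⟩
  rw [Cardinal.Real.Ioc_countable_iff] at h2
  linarith [Real.pi_pos]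

/-- The entry φ_1(w) alone separates points: it is a nonzero constant times w - conj(α_0). -/
lemma IsAlexandrov.not_countable_range {b : ℝ} (hb : -(1 / 2) < b) (hb0 : b < 0) {c : Circle}
    {ν : Measure Circle} (hν : IsAlexandrov (sinMeasure b) c ν) :
    ¬ (Set.range (opFamily ν)).Countable := by
  intro h
  apply not_countable_ne_one
  have hinj : Function.Injective (opFamily ν) := by
    intro w w' hww
    have h1 := congrFun hww 1
    obtain ⟨m, hm, hmP⟩ := exists_pos_le_prod_sinCoeff hb hb0
    have hne : (((Real.sqrt (∏ k ∈ Finset.range 1, (1 - sinCoeff b k ^ 2)))⁻¹ : ℝ) : ℂ) ≠ 0 :=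
      Complex.ofReal_ne_zero.mpr (inv_ne_zero (Real.sqrt_pos.mpr (hm.trans_le (hmP 1))).ne')
    simp only [opFamily] at h1
    rw [hν.opVec_eq hb hb0, hν.opVec_eq hb hb0] at h1
    have h2 := mul_left_cancel₀ hne h1
    simp only [szegoPoly_succ, szegoPoly_zero, szegoDual_zero, eval_sub, eval_X, eval_C, mul_one,
      sub_left_inj] at h2
    exact Subtype.ext (Circle.ext h2)
  have := h.to_subtype
  exact (Equiv.ofInjective _ hinj).countable_iff.mpr this

/-- The value at `1` for real coefficients. -/
lemma szegoPoly_eval_one_of_real (a : ℕ → ℝ) (n : ℕ) :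
    (szegoPoly (fun n => ((1 : Circle) : ℂ) * a n) n).eval 1 =
      ((∏ k ∈ Finset.range n, (1 - a k) : ℝ) : ℂ) ∧
    (szegoDual (fun n => ((1 : Circle) : ℂ) * a n) n).eval 1 =
      ((∏ k ∈ Finset.range n, (1 - a k) : ℝ) : ℂ) := by
  induction n with
  | zero => simp
  | succ n ih =>
    rw [szegoPoly_succ, szegoDual_succ, Finset.prod_range_succ]
    simp only [eval_sub, eval_mul, eval_C, eval_X, ih.1, ih.2]
    simp only [Circle.coe_one, one_mul, Complex.conj_ofReal]
    push_cast
    constructor <;> ring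

/-- The real number `φ_n(1)`. -/
def sinVec (b : ℝ) (n : ℕ) : ℝ :=
  (Real.sqrt (∏ k ∈ Finset.range n, (1 - sinCoeff b k ^ 2)))⁻¹ *
    ∏ k ∈ Finset.range n, (1 - sinCoeff b k)

lemma opVec_sinMeasure_one {b : ℝ} (hb : -(1 / 2) < b) (hb0 : b < 0) (n : ℕ) :
    opVec (sinMeasure b) 1 n = sinVec b n := by
  rw [(sinMeasure_isAlexandrov_one hb hb0).opVec_eq hb hb0, sinVec, Complex.ofReal_mul,
    ← (szegoPoly_eval_one_of_real (sinCoeff b) n).1]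
  simp only [Circle.coe_one]

lemma sinVec_nonneg {b : ℝ} (hb : -(1 / 2) < b) (n : ℕ) : 0 ≤ sinVec b n :=
  mul_nonneg (by positivity)
    (Finset.prod_nonneg fun k _ => sub_nonneg.mpr (sinCoeff_lt_one hb k).le)

/-- Each factor is (1-a)²/(1-a²) = (1-a)/(1+a) with a = -b/(k+1+b), that is (k+1+2b)/(k+1). -/
lemma sinVec_sq {b : ℝ} (hb : -(1 / 2) < b) (hb0 : b < 0) (n : ℕ) :
    sinVec b n ^ 2 = ∏ k ∈ Finset.range n, (1 + 2 * b / (k + 1)) := by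
  have hpos : ∀ k, 0 < 1 - sinCoeff b k ^ 2 := fun k => by
    nlinarith [sinCoeff_pos hb hb0 k, sinCoeff_lt_one hb k]
  rw [sinVec, mul_pow, inv_pow, Real.sq_sqrt (Finset.prod_nonneg fun k _ => (hpos k).le),
    ← Finset.prod_inv_distrib, ← Finset.prod_pow, ← Finset.prod_mul_distrib]
  refine Finset.prod_congr rfl fun k _ => ?_
  rw [inv_mul_eq_iff_eq_mul₀ (hpos k).ne', sinCoeff]
  have := sinCoeff_den_pos hb k
  field_simp
  ring

lemma memℓp_top_opVec_sinMeasure {b : ℝ} (hb : -(1 / 2) < b) (hb0 : b < 0) :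
    Memℓp (opVec (sinMeasure b) 1) ⊤ := by
  refine memℓp_infty ⟨1, ?_⟩
  rintro _ ⟨n, rfl⟩
  beta_reduce
  rw [opVec_sinMeasure_one hb hb0, Complex.norm_real, Real.norm_of_nonneg (sinVec_nonneg hb n)]
  refine (sq_le_one_iff₀ (sinVec_nonneg hb n)).mp ?_
  rw [sinVec_sq hb hb0]
  refine Finset.prod_le_one (fun k _ => ?_) fun k _ => ?_
  · have : -1 ≤ 2 * b / ((k : ℝ) + 1) := by
      rw [le_div_iff₀ (by positivity)]
      have : (0 : ℝ) ≤ k := k.cast_nonneg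
      linarith
    linarith
  · have : 2 * b / ((k : ℝ) + 1) ≤ 0 := div_nonpos_of_nonpos_of_nonneg (by linarith) (by positivity)
    linarith

/-- Since 2b > -1, 1 + 2b/(k+1) ≥ k/(k+1); telescoping from k = 1 bounds φ_{n+1}(1)² below by
(1+2b)/(n+1). A number in [0, 1] is at most its square root, so φ_{n+1}(1) itself dominates a
multiple of the harmonic series. -/
lemma not_memℓp_one_opVec_sinMeasure {b : ℝ} (hb : -(1 / 2) < b) (hb0 : b < 0) :
    ¬ Memℓp (opVec (sinMeasure b) 1) 1 := by
  intro h
  have hs : Summable (sinVec b) := by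
    have := (memℓp_gen_iff (by simp)).mp h
    simpa [opVec_sinMeasure_one hb hb0, abs_of_nonneg (sinVec_nonneg hb _)] using this
  have hc : 0 < 1 + 2 * b := by linarith
  have hlow : ∀ n : ℕ, (1 + 2 * b) / (n + 1) ≤ sinVec b (n + 1) ^ 2 := by
    intro n
    rw [sinVec_sq hb hb0]
    induction n with
    | zero => simp
    | succ n ih =>
      rw [Finset.prod_range_succ]
      push_cast
      have h1 : ((n : ℝ) + 1) / (n + 1 + 1) ≤ 1 + 2 * b / (n + 1 + 1) := by
        rw [div_le_iff₀ (by positivity)]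
        field_simp
        linarith
      calc (1 + 2 * b) / ((n : ℝ) + 1 + 1) =
          (1 + 2 * b) / (n + 1) * ((n + 1) / (n + 1 + 1)) := by field_simp
        _ ≤ _ := mul_le_mul ih h1 (by positivity) (le_trans (by positivity) ih)
  apply Real.not_summable_one_div_natCast
  rw [← summable_nat_add_iff 1]
  refine Summable.of_nonneg_of_le (fun n => by positivity) (fun n => ?_)
    (((summable_nat_add_iff 1).mpr hs).mul_left (1 + 2 * b)⁻¹)
  rw [le_inv_mul_iff₀ hc, mul_one_div]
  push_cast
  have hle : (1 + 2 * b) / ((n : ℝ) + 1) ≤ 1 := by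
    rw [div_le_one (by positivity)]
    have : (0 : ℝ) ≤ n := n.cast_nonneg
    linarith
  have h0 : 0 ≤ (1 + 2 * b) / ((n : ℝ) + 1) := by positivity
  refine le_of_sq_le_sq ?_ (sinVec_nonneg hb _)
  nlinarith [hlow n]

/-! ### Balancedness -/

/-- Both normalizations are (∏(1-a_k²))^(-1/2), so the weight in front of Φ_n(w) is
∏(1-a_k)/∏(1-a_k²) = ∏(1+a_k)⁻¹. -/
lemma IsAlexandrov.exists_hasPairing {b : ℝ} (hb : -(1 / 2) < b) (hb0 : b < 0) {c : Circle}
    {ν : Measure Circle} (hν : IsAlexandrov (sinMeasure b) c ν) (w : {w : Circle // w ≠ 1}) :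
    ∃ l, HasPairing (opVec (sinMeasure b) 1) (opFamily ν w) l := by
  obtain ⟨l, hl⟩ := exists_tendsto_sum_prod_inv_mul (fun n => (sinCoeff_pos hb hb0 n).le)
    (fun n => (sinCoeff_lt_one hb n).le) (sinCoeff_antitone hb hb0) (summable_sinCoeff_sq hb hb0)
    (not_summable_sinCoeff hb hb0) c w.2
  refine ⟨l, hl.congr fun N => Finset.sum_congr rfl fun n _ => ?_⟩
  rw [opVec_sinMeasure_one hb hb0, Complex.conj_ofReal, opFamily, hν.opVec_eq hb hb0, ← mul_assoc,
    ← Complex.ofReal_mul]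
  congr 2
  have hpos : ∀ k, 0 < 1 - sinCoeff b k := fun k => by linarith [sinCoeff_lt_one hb k]
  have hpos' : ∀ k, 0 < 1 + sinCoeff b k := fun k => by linarith [sinCoeff_pos hb hb0 k]
  have hA : 0 < ∏ k ∈ Finset.range n, (1 - sinCoeff b k) := Finset.prod_pos fun k _ => hpos k
  have hB : 0 < ∏ k ∈ Finset.range n, (1 + sinCoeff b k) := Finset.prod_pos fun k _ => hpos' k
  have hprod : ∏ k ∈ Finset.range n, (1 - sinCoeff b k ^ 2) =
      (∏ k ∈ Finset.range n, (1 - sinCoeff b k)) * ∏ k ∈ Finset.range n, (1 + sinCoeff b k) := by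
    rw [← Finset.prod_mul_distrib]
    exact Finset.prod_congr rfl fun k _ => by ring
  have hsq := Real.sq_sqrt (mul_pos hA hB).le
  have hs := Real.sqrt_pos.mpr (mul_pos hA hB)
  rw [sinVec, hprod]
  generalize Real.sqrt _ = s at hs hsq ⊢
  field_simp
  linear_combination hsq

lemma IsAlexandrov.opVec_inv {b : ℝ} (hb : -(1 / 2) < b) (hb0 : b < 0) {c : Circle}
    {ν ν' : Measure Circle} (hν : IsAlexandrov (sinMeasure b) c ν)
    (hν' : IsAlexandrov (sinMeasure b) c⁻¹ ν') (w : Circle) (n : ℕ) :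
    opVec ν' w⁻¹ n = conj (opVec ν w n) := by
  rw [hν.opVec_eq hb hb0, hν'.opVec_eq hb hb0, map_mul, Complex.conj_ofReal, ← (szego_conj _ _ n).1,
    Circle.coe_inv_eq_conj, Circle.coe_inv_eq_conj]
  simp only [map_mul, Complex.conj_ofReal]

/-- The point w⁻¹ is the partner of w: as φ_n(1) is real, its pairing is the conjugate one. The
reverse inclusion is the same statement for c⁻¹. -/
lemma IsAlexandrov.pairingAbsSet_subset {b : ℝ} (hb : -(1 / 2) < b) (hb0 : b < 0) {c : Circle}
    {ν ν' : Measure Circle} (hν : IsAlexandrov (sinMeasure b) c ν)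
    (hν' : IsAlexandrov (sinMeasure b) c⁻¹ ν') :
    pairingAbsSet (opVec (sinMeasure b) 1) (opFamily ν) ⊆
      pairingAbsSet (opVec (sinMeasure b) 1) (opFamily ν') := by
  rintro r ⟨w, l, hl, rfl⟩
  refine ⟨⟨w.1⁻¹, inv_ne_one.mpr w.2⟩, conj l, ?_, (RCLike.norm_conj l).symm⟩
  refine ((Complex.continuous_conj.tendsto l).comp hl).congr fun N => ?_
  simp only [Function.comp_apply, map_sum, map_mul, opFamily, hν.opVec_inv hb hb0 hν',
    opVec_sinMeasure_one hb hb0, Complex.conj_ofReal]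

lemma IsAlexandrov.isBalanced {b : ℝ} (hb : -(1 / 2) < b) (hb0 : b < 0) {c : Circle}
    {ν ν' : Measure Circle} (hν : IsAlexandrov (sinMeasure b) c ν)
    (hν' : IsAlexandrov (sinMeasure b) c⁻¹ ν') :
    IsBalanced (opVec (sinMeasure b) 1) (opFamily ν) (opFamily ν') where
  converges_left := hν.exists_hasPairing hb hb0
  converges_right := hν'.exists_hasPairing hb hb0
  abs_eq := (hν.pairingAbsSet_subset hb hb0 hν').antisymm
    (hν'.pairingAbsSet_subset hb hb0 (by rwa [inv_inv]))

end OPUC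

end

/-- For `μ = τ sin(θ/2)^{2b} dθ` with `-1/2 < b < 0` and `lam ≠ ±1` on the circle (where
`lam⁻¹` is the complex conjugate of `lam`): the measures `μ`, `μ^(lam)`, `μ^(conj lam)` are
well defined, the two families are uncountable and consist of bounded sequences, the vector
`(φ_n(1))_n` is bounded but not in `ℓ¹`, and it is balanced with respect to the two families. -/
theorem theorem4p4 (b : ℝ) (hb : -(1 / 2) < b) (hb0 : b < 0)
    (lam : Circle) (h1 : (lam : ℂ) ≠ 1) (h2 : (lam : ℂ) ≠ -1) :
    OPUC.IsNontrivial (OPUC.sinMeasure b) ∧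
    (∃ ν, OPUC.IsAlexandrov (OPUC.sinMeasure b) lam ν) ∧
    (∃ ν, OPUC.IsAlexandrov (OPUC.sinMeasure b) lam⁻¹ ν) ∧
    Memℓp (OPUC.opVec (OPUC.sinMeasure b) 1) ⊤ ∧
    ¬ Memℓp (OPUC.opVec (OPUC.sinMeasure b) 1) 1 ∧
    ∀ ν ν' : MeasureTheory.Measure Circle,
      OPUC.IsAlexandrov (OPUC.sinMeasure b) lam ν →
      OPUC.IsAlexandrov (OPUC.sinMeasure b) lam⁻¹ ν' →
        (∀ w, Memℓp (OPUC.opFamily ν w) ⊤) ∧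
        (∀ w, Memℓp (OPUC.opFamily ν' w) ⊤) ∧
        ¬ (Set.range (OPUC.opFamily ν)).Countable ∧
        ¬ (Set.range (OPUC.opFamily ν')).Countable ∧
        OPUC.IsBalanced (OPUC.opVec (OPUC.sinMeasure b) 1)
          (OPUC.opFamily ν) (OPUC.opFamily ν') := by
  open OPUC in
  exact ⟨(sinMeasure_isNontrivial hb hb0).1, exists_isAlexandrov hb hb0 lam,
    exists_isAlexandrov hb hb0 lam⁻¹, memℓp_top_opVec_sinMeasure hb hb0,
    not_memℓp_one_opVec_sinMeasure hb hb0, fun ν ν' hν hν' =>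
    ⟨hν.memℓp_opFamily hb hb0, hν'.memℓp_opFamily hb hb0, hν.not_countable_range hb hb0,
      hν'.not_countable_range hb hb0, hν.isBalanced hb hb0 hν'⟩⟩
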